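/- All graphs are finite and simple; $u\sim v$ denotes adjacency. **Setting.** A binate interval graph is a graph whose vertex set can be partitioned into two sets each inducing a connected unit interval graph. A $B_{a,b}$-graph is a binate interval graph $G$ with $V(G)=X\sqcup Y$, $X=X_a\cup X_b$, where $X_a,X_b,Y$ are cliques, $X_a\cap X_b\ne\emptyset$, and no vertex of $A:=X_a\setminus X_b$ is adjacent to a vertex of $B:=X_b\setminus X_a$. Write $N_S(v)=\{w\in S: v\sim w\}$. A pair $\{x_1y_1,x_2y_2\}$ of edges with $x_1,x_2\in X$, $y_1,y_2\in Y$ is *rigid* if $x_1y_1y_2x_2$ is an induced 4-cycle; its chords are $x_1y_2$ and $x_2y_1$. The *chord graph* $\tilde G$ has as vertices the non-edges $xy$ ($x\in X$, $y\in Y$) of $G$, two of them being adjacent iff they are the two chords of a rigid pair. For $S\subseteq X$ call $xy\in V(\tilde G)$ an $S$-vertex if $x\in S$. Let $\mathcal A$ be the set of $A$-vertices having a neighbour in $\tilde G$ that is not an $A$-vertex, and $\mathcal B$ the set of $B$-vertices having a neighbour in $\tilde G$ that is not a $B$-vertex. **Assumption on $G$.** $G$ is a $B_{a,b}$-graph such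 that: $\tilde G$ is connected up to isolated vertices (any two non-isolated vertices of $\tilde G$ are joined by a path; this holds in particular if $\tilde G$ is connected); $0<|N_Y(v)|<|Y|$ for all $v\in A\cup B$; for every $b\in B$ there is $u\in X$ with $N_Y(b)\not\subseteq N_Y(u)$; and $\tilde G$ has an edge neither of whose ends is an $A$-vertex or a $B$-vertex. **Hypotheses.** 1. $f:V(\tilde G)\to\{\text{red},\text{blue}\}$ is a proper 2-colouring with all of $\mathcal A$ red and all of $\mathcal B$ blue, and the following (reflexive) relations are partial orders: $x<_X x'$ iff $x=x'$ or there is a rigid pair $\{xy,x'y'\}$ with $f(xy')$ red and $f(x'y)$ blue; $y<_Y y'$ iff $y=y'$ or there is a rigid pair $\{xy,x'y'\}$ with $f(xy')$ red and $f(x'y)$ blue. 2. The sets $N_Y(v)$, $v\in A$, form a chain under inclusion, and so do the sets $N_Y(v)$, $v\in B$. 3. At least one of the following holds. (RF$_A$) For every $a\in A$, all $x,x_1,x_2\in X_a\cap X_b$ and all $b\in B$, there is no rigid pair whose two vertices in $X$ belong to $\{x_1,x_2\}$ and whose two vertices in $Y$ belong to $N_Y(a)$, nor one whose two vertices in $X$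 belong to $\{x,b\}$ and whose two vertices in $Y$ belong to $N_Y(a)$. (RF$_B$) The same with $X_a$ and $X_b$ (hence $A$ and $B$) exchanged. **The orders.** Fix an arbitrary linear order $\preceq$ on $V(G)$, used only to break ties. For $x,x'\in X$ write $x\subseteq^* x'$ if $N_Y(x)\subsetneq N_Y(x')$, or $N_Y(x)=N_Y(x')$ and $x\preceq x'$. For $y,y'\in Y$ write $y\supseteq^* y'$ if $N_X(y')\subsetneq N_X(y)$, or $N_X(y')=N_X(y)$ and $y\preceq y'$. Let $<_1$ and $<_2$ be the (reflexive) relations on $V(G)$ consisting exactly of the following pairs. Relation $<_1$: * $x<_1x'$ for $x,x'\in X_a\cap X_b$ with $x<_Xx'$ or $x\subseteq^*x'$; * $a<_1a'$ for $a,a'\in A$ with $a\subseteq^*a'$; $b<_1b'$ for $b,b'\in B$ with $b\subseteq^*b'$; and $a<_1x<_1b$, $a<_1b$ for all $a\in A$, $x\in X_a\cap X_b$, $b\in B$; * $y<_1y'$ for $y,y'\in Y$ with $y<_Yy'$ or $y\supseteq^*y'$; * $y<_1y'$ for $y,y'\in Y$ such that $N_X(y)\setminus N_X(y')$ and $N_X(y')\setminus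 N_X(y)$ are non-empty subsets of $A$ and of $B$, respectively; * $y<_1b$ for $b\in B$ and $y\in Y$ having a neighbour in $A$; $b<_1y$ for $b\in B$ and $y\in Y$ having no neighbour in $A$; * $x<_1y$ for all $x\in X_a$, $y\in Y$. Relation $<_2$: * $x<_2x'$ for $x,x'\in X$ with $x'<_Xx$ or $x\subseteq^*x'$; * $b<_2a$ for $a\in A$, $b\in B$ with $N_Y(a)\not\subseteq N_Y(b)$ and $N_Y(b)\not\subseteq N_Y(a)$; * $y<_2y'$ for $y,y'\in Y$ with $y'<_Yy$ or $y\supseteq^*y'$; * $y<_2y'$ for $y,y'\in Y$ such that $N_X(y')\setminus N_X(y)$ and $N_X(y)\setminus N_X(y')$ are non-empty subsets of $A$ and of $B$, respectively; * $x<_2y$ for all $x\in X$, $y\in Y$. **Theorem.** Under the assumption and hypotheses above: * If (RF$_A$) holds, then $<_1$ and $<_2$ are (reflexive) linear orders on $V(G)$ satisfying the two-order condition: for all $u,v,x,y,s,t\in V(G)$ with $s\neq t$, if $u\sim v$, $u\le_1 s\le_1 v$, $u\le_1 t\le_1 v$ and $x\sim y$, $x\le_2 s\le_2 y$, $x\le_2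 t\le_2 y$, then $s\sim t$ (here $\le_i$ is the reflexive order $<_i$). * If (RF$_B$) holds, the same is true of the relations defined in the same way after exchanging $X_a$ with $X_b$ (hence $A$ with $B$) and red with blue. * In either case $G$ is square geometric: there is $p:V(G)\to\mathbb R^2$ such that, for all $u\ne v$, $u\sim v$ if and only if $\|p(u)-p(v)\|_\infty\le 1$. -/

import Mathlib

namespace SquareGeometric

variable {V : Type*}

/-- `G` is a unit interval graph: vertices are points of the line, and distinct vertices are
adjacent exactly when their distance is at most one. -/
def IsUnitInterval (G : SimpleGraph V) : Prop :=
  ∃ p : V → ℝ, ∀ u v, u ≠ v → (G.Adj u v ↔ |p u - p v| ≤ 1)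

/-- `G` is square geometric: vertices are points of the plane with the sup norm (the distance that
Mathlib puts on `ℝ × ℝ`), distinct vertices being adjacent exactly at distance at most one. -/
def IsSquareGeometric (G : SimpleGraph V) : Prop :=
  ∃ p : V → ℝ × ℝ, ∀ u v, u ≠ v → (G.Adj u v ↔ dist (p u) (p v) ≤ 1)

/-- The vertex set splits into two sets, each inducing a connected unit interval graph. -/
def IsBinateInterval (G : SimpleGraph V) : Prop :=
  ∃ U W : Set V, Disjoint U W ∧ U ∪ W = Set.univ ∧
    (G.induce U).Connected ∧ IsUnitInterval (G.induce U) ∧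
    (G.induce W).Connected ∧ IsUnitInterval (G.induce W)

/-- `G` is a `B_{a,b}`-graph with clique bipartition `Xa ∪ Xb`, `Y`. Vertices of `Xa \ Xb` are not
adjacent to vertices of `Xb \ Xa`. -/
structure IsBab (G : SimpleGraph V) (Xa Xb Y : Set V) : Prop where
  binate : IsBinateInterval G
  disjoint : Disjoint (Xa ∪ Xb) Y
  cover : (Xa ∪ Xb) ∪ Y = Set.univ
  clique_Xa : G.IsClique Xa
  clique_Xb : G.IsClique Xb
  clique_Y : G.IsClique Y
  inter_nonempty : (Xa ∩ Xb).Nonempty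
  not_adj : ∀ a ∈ Xa \ Xb, ∀ b ∈ Xb \ Xa, ¬ G.Adj a b

/-- The neighbourhood `N_S(v)` of `v` inside the set `S`. -/
def nbr (G : SimpleGraph V) (S : Set V) (v : V) : Set V := {w | w ∈ S ∧ G.Adj v w}

/-- `{x₁y₁, x₂y₂}` is a rigid pair: `x₁ y₁ y₂ x₂` is an induced 4-cycle. -/
structure IsRigidPair (G : SimpleGraph V) (X Y : Set V) (x₁ y₁ x₂ y₂ : V) : Prop where
  x₁_mem : x₁ ∈ X
  x₂_mem : x₂ ∈ X
  y₁_mem : y₁ ∈ Y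
  y₂_mem : y₂ ∈ Y
  adj₁ : G.Adj x₁ y₁
  adj_y : G.Adj y₁ y₂
  adj₂ : G.Adj x₂ y₂
  adj_x : G.Adj x₁ x₂
  chord₁ : ¬ G.Adj x₁ y₂
  chord₂ : ¬ G.Adj x₂ y₁

theorem IsRigidPair.symm {G : SimpleGraph V} {X Y : Set V} {x₁ y₁ x₂ y₂ : V}
    (h : IsRigidPair G X Y x₁ y₁ x₂ y₂) : IsRigidPair G X Y x₂ y₂ x₁ y₁ :=
  ⟨h.x₂_mem, h.x₁_mem, h.y₂_mem, h.y₁_mem, h.adj₂, h.adj_y.symm, h.adj₁, h.adj_x.symm,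
    h.chord₂, h.chord₁⟩

/-- The vertices of the chord graph: the non-edges `xy` of `G` with `x ∈ X`, `y ∈ Y`. -/
def NonEdge (G : SimpleGraph V) (X Y : Set V) : Type _ :=
  {p : V × V // p.1 ∈ X ∧ p.2 ∈ Y ∧ ¬ G.Adj p.1 p.2}

/-- The endpoint in `X` of a non-edge. -/
def NonEdge.fst {G : SimpleGraph V} {X Y : Set V} (u : NonEdge G X Y) : V := u.1.1

/-- The endpoint in `Y` of a non-edge. -/
def NonEdge.snd {G : SimpleGraph V} {X Y : Set V} (u : NonEdge G X Y) : V := u.1.2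

/-- The chord `x₁y₂` of a rigid pair `{x₁y₁, x₂y₂}`. The other chord, `x₂y₁`, is `h.symm.chord`. -/
def IsRigidPair.chord {G : SimpleGraph V} {X Y : Set V} {x₁ y₁ x₂ y₂ : V}
    (h : IsRigidPair G X Y x₁ y₁ x₂ y₂) : NonEdge G X Y :=
  ⟨(x₁, y₂), h.x₁_mem, h.y₂_mem, h.chord₁⟩

/-- The chord graph: two non-edges are adjacent when they are the two chords of a rigid pair. -/
def chordGraph (G : SimpleGraph V) (X Y : Set V) : SimpleGraph (NonEdge G X Y) where
  Adj u v := IsRigidPair G X Y u.fst v.snd v.fst u.snd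
  symm := ⟨fun _ _ h => h.symm⟩
  loopless := ⟨fun _ h => G.loopless.irrefl _ h.adj_x⟩

/-- A non-edge that is not an isolated vertex of the chord graph. -/
def NonIsolated (G : SimpleGraph V) (X Y : Set V) (u : NonEdge G X Y) : Prop :=
  ∃ v, (chordGraph G X Y).Adj u v

/-- The general assumption on `G`. Isolated vertices of the chord graph are
disregarded in the connectedness requirement, so that it is weaker than connectedness. -/
structure StandingAssumption (G : SimpleGraph V) (Xa Xb Y : Set V) : Prop where
  bab : IsBab G Xa Xb Y
  chord_connected : ∀ u v : NonEdge G (Xa ∪ Xb) Y,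
    NonIsolated G (Xa ∪ Xb) Y u → NonIsolated G (Xa ∪ Xb) Y v →
      (chordGraph G (Xa ∪ Xb) Y).Reachable u v
  nbr_proper : ∀ v ∈ (Xa \ Xb) ∪ (Xb \ Xa), nbr G Y v ≠ ∅ ∧ nbr G Y v ≠ Y
  b_not_least : ∀ b ∈ Xb \ Xa, ∃ u ∈ Xa ∪ Xb, ¬ nbr G Y b ⊆ nbr G Y u
  inner_edge : ∃ u v : NonEdge G (Xa ∪ Xb) Y, (chordGraph G (Xa ∪ Xb) Y).Adj u v ∧
    u.fst ∉ (Xa \ Xb) ∪ (Xb \ Xa) ∧ v.fst ∉ (Xa \ Xb) ∪ (Xb \ Xa)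

/-- The two colours. -/
inductive Colour
  | red
  | blue

/-- Exchange of the two colours. -/
def Colour.swap : Colour → Colour
  | red => blue
  | blue => red

/-- The non-edges `sy` with `s ∈ S` that have a neighbour in the chord graph not of this form. For
`S = Xa \ Xb` this is the set `𝒜`, for `S = Xb \ Xa` the set `ℬ`. -/
def crossing (G : SimpleGraph V) (X Y S : Set V) : Set (NonEdge G X Y) :=
  {u | u.fst ∈ S ∧ ∃ v, (chordGraph G X Y).Adj u v ∧ v.fst ∉ S}

/-- The relation `<_X` of a colouring (it is reflexive). -/
def relX (G : SimpleGraph V) (X Y : Set V) (f : NonEdge G X Y → Colour) (x x' : V) : Prop :=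
  x = x' ∨ ∃ y y', ∃ h : IsRigidPair G X Y x y x' y',
    f h.chord = Colour.red ∧ f h.symm.chord = Colour.blue

/-- The relation `<_Y` of a colouring (it is reflexive). -/
def relY (G : SimpleGraph V) (X Y : Set V) (f : NonEdge G X Y → Colour) (y y' : V) : Prop :=
  y = y' ∨ ∃ x x', ∃ h : IsRigidPair G X Y x y x' y',
    f h.chord = Colour.red ∧ f h.symm.chord = Colour.blue

/-- The vertices of `S` have nested neighbourhoods in `Y`. -/
def NestedNbrs (G : SimpleGraph V) (Y S : Set V) : Prop :=
  ∀ v ∈ S, ∀ w ∈ S, nbr G Y v ⊆ nbr G Y w ∨ nbr G Y w ⊆ nbr G Y v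

/-- `v` is rigid-free with respect to `S`. -/
def RigidFree (G : SimpleGraph V) (X Y : Set V) (v : V) (S : Set V) : Prop :=
  ¬ ∃ x₁ y₁ x₂ y₂, IsRigidPair G X Y x₁ y₁ x₂ y₂ ∧ x₁ ∈ S ∧ x₂ ∈ S ∧
    y₁ ∈ nbr G Y v ∧ y₂ ∈ nbr G Y v

/-- The vertices of `Xa \ Xb` satisfy the rigid-free conditions. -/
def RigidFreeConditions (G : SimpleGraph V) (Xa Xb Y : Set V) : Prop :=
  ∀ a ∈ Xa \ Xb,
    (∀ x₁ ∈ Xa ∩ Xb, ∀ x₂ ∈ Xa ∩ Xb, RigidFree G (Xa ∪ Xb) Y a {x₁, x₂}) ∧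
    (∀ x ∈ Xa ∩ Xb, ∀ b ∈ Xb \ Xa, RigidFree G (Xa ∪ Xb) Y a {x, b})

/-- `N_Y(x) ⊆ N_Y(x')`, where in the case of equality `x` precedes `x'` in the order `tie`. -/
def subX (G : SimpleGraph V) (Y : Set V) (tie : V → V → Prop) (x x' : V) : Prop :=
  nbr G Y x ⊂ nbr G Y x' ∨ (nbr G Y x = nbr G Y x' ∧ tie x x')

/-- `N_X(y') ⊆ N_X(y)`, where in the case of equality `y` precedes `y'` in the order `tie`. -/
def supY (G : SimpleGraph V) (X : Set V) (tie : V → V → Prop) (y y' : V) : Prop :=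
  nbr G X y' ⊂ nbr G X y ∨ (nbr G X y' = nbr G X y ∧ tie y y')

/-- `N_X(y) \ N_X(y')` and `N_X(y') \ N_X(y)` are non-empty subsets of `P` and `Q`. -/
def Splits (G : SimpleGraph V) (X P Q : Set V) (y y' : V) : Prop :=
  (nbr G X y \ nbr G X y').Nonempty ∧ (nbr G X y' \ nbr G X y).Nonempty ∧
  nbr G X y \ nbr G X y' ⊆ P ∧ nbr G X y' \ nbr G X y ⊆ Q

/-- The relation `<₁` (it is reflexive), built from `<_X` and `<_Y`. -/
def le₁ (G : SimpleGraph V) (Xa Xb Y : Set V) (ltX ltY tie : V → V → Prop) (u v : V) : Prop :=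
  -- on `Xa ∩ Xb`
  (u ∈ Xa ∩ Xb ∧ v ∈ Xa ∩ Xb ∧ (ltX u v ∨ subX G Y tie u v)) ∨
  -- on `Xa \ Xb` and on `Xb \ Xa`, by increasing neighbourhoods
  (u ∈ Xa \ Xb ∧ v ∈ Xa \ Xb ∧ subX G Y tie u v) ∨
  (u ∈ Xb \ Xa ∧ v ∈ Xb \ Xa ∧ subX G Y tie u v) ∨
  -- `Xa \ Xb` before `Xa ∩ Xb` before `Xb \ Xa`
  (u ∈ Xa \ Xb ∧ v ∈ Xa ∩ Xb) ∨
  (u ∈ Xa ∩ Xb ∧ v ∈ Xb \ Xa) ∨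
  (u ∈ Xa \ Xb ∧ v ∈ Xb \ Xa) ∨
  -- on `Y`
  (u ∈ Y ∧ v ∈ Y ∧
    (ltY u v ∨ supY G (Xa ∪ Xb) tie u v ∨ Splits G (Xa ∪ Xb) (Xa \ Xb) (Xb \ Xa) u v)) ∨
  -- `Xb \ Xa` after the vertices of `Y` that have a neighbour in `Xa \ Xb`, before the others
  (u ∈ Y ∧ v ∈ Xb \ Xa ∧ ∃ a ∈ Xa \ Xb, u ∈ nbr G Y a) ∨
  (u ∈ Xb \ Xa ∧ v ∈ Y ∧ ∀ a ∈ Xa \ Xb, v ∉ nbr G Y a) ∨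
  -- `Xa` before `Y`
  (u ∈ Xa ∧ v ∈ Y)

/-- The relation `<₂` (it is reflexive), built from `<_X` and `<_Y`. -/
def le₂ (G : SimpleGraph V) (Xa Xb Y : Set V) (ltX ltY tie : V → V → Prop) (u v : V) : Prop :=
  -- on `Xa ∪ Xb`
  (u ∈ Xa ∪ Xb ∧ v ∈ Xa ∪ Xb ∧ (ltX v u ∨ subX G Y tie u v)) ∨
  -- `b` before `a` when their neighbourhoods are not nested
  (u ∈ Xb \ Xa ∧ v ∈ Xa \ Xb ∧ ¬ nbr G Y v ⊆ nbr G Y u ∧ ¬ nbr G Y u ⊆ nbr G Y v) ∨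
  -- on `Y`
  (u ∈ Y ∧ v ∈ Y ∧
    (ltY v u ∨ supY G (Xa ∪ Xb) tie u v ∨ Splits G (Xa ∪ Xb) (Xb \ Xa) (Xa \ Xb) u v)) ∨
  -- `Xa ∪ Xb` before `Y`
  (u ∈ Xa ∪ Xb ∧ v ∈ Y)

/-- The two-order condition, for reflexive orders `r₁` and `r₂`: two vertices that lie, in each of
the two orders, between the ends of some edge are adjacent. -/
def TwoOrderCondition (G : SimpleGraph V) (r₁ r₂ : V → V → Prop) : Prop :=
  ∀ u v x y a b : V, a ≠ b →
    r₁ u a → r₁ a v → r₁ u b → r₁ b v → G.Adj u v →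
    r₂ x a → r₂ a y → r₂ x b → r₂ b y → G.Adj x y → G.Adj a b

/-- The relations `<₁` and `<₂` built from `<_X` and `<_Y` are linear orders that satisfy the
two-order condition. -/
def OrdersWork (G : SimpleGraph V) (Xa Xb Y : Set V) (ltX ltY tie : V → V → Prop) : Prop :=
  IsLinearOrder V (le₁ G Xa Xb Y ltX ltY tie) ∧
  IsLinearOrder V (le₂ G Xa Xb Y ltX ltY tie) ∧
  TwoOrderCondition G (le₁ G Xa Xb Y ltX ltY tie) (le₂ G Xa Xb Y ltX ltY tie)

end SquareGeometric

/-!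
The non-edges between `X = Xa ∪ Xb` and `Y` are separated by the colours. If an edge spans a
non-edge `st`, where `s ∈ Xa ∩ Xb` and `t ∈ Y`, in the first order, then `st` is a blue chord of some
rigid pair; if an edge spans it in the second order, it is a red chord. So no non-edge of this kind is
spanned in both orders, and this is the two-order condition. The case that does not fit is that of
an edge with an end in `Xa \ Xb`, or with an end in `Xb \ Xa`, that spans `st` in the first order
merely because of the position of these blocks. Then `t` has a neighbour `a ∈ Xa \ Xb`, and the
rigid-free conditions at `a` make every chord `st` blue (`not_red_of_rigidFree`). If `s` lies in
`Xa \ Xb` or in `Xb \ Xa`, one of the two orders suffices (`false_of_mem_diff`), as it does for the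
non-edges between `Xa \ Xb` and `Xb \ Xa` (`false_of_between`).

The hypotheses are invariant under exchanging `Xa` with `Xb` and red with blue, and the exchange
reverses `<_X` and `<_Y`. Hence the statements about the second order are those about the first one
for the complementary colouring (`IsAdmissible.compl`, `ordY_compl`), and a single lemma,
`exists_not_red`, does for both colours. It rests on the following consequence of nestedness: a
rigid pair has at least one vertex in `Xa ∩ Xb`, and its red chord starts in `Xa`, its blue one in
`Xb`. So whenever non-adjacency of vertices of `X` could be an obstacle, the colours rule it out.

That the relations are linear orders comes down to total relations without 3-cycles on a few blocks.
On each block the relation is a partial order `r` (`<_X`, `<_Y` or its reverse), completed by the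
inclusion of neighbourhoods with ties and by some pairs `p` that neither of the two compares;
`Completes` lists the cycles that have to be excluded, and the colours exclude them.

Finally, two linear orders with the two-order condition make `G` the intersection of two unit
interval graphs, which gives the two coordinates (`TwoOrderCondition.isSquareGeometric`).
-/

namespace SquareGeometric

variable {V : Type*}

/-! ### Linear orders from a rank and from a partial order with ties -/

/-- `r` is a linear order on `S`. Transitivity is phrased as the absence of 3-cycles, which for a
total relation is equivalent and lends itself better to case analysis: the three steps of a cycle
can be rotated. -/
structure LinearOn (S : Set V) (r : V → V → Prop) : Prop where
  total : ∀ {u v}, u ∈ S → v ∈ S → r u v ∨ r v u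
  antisymm : ∀ {u v}, u ∈ S → v ∈ S → r u v → r v u → u = v
  eq_of_cycle : ∀ {u v w}, u ∈ S → v ∈ S → w ∈ S → r u v → r v w → r w u → u = v ∨ v = w ∨ w = u

theorem LinearOn.mono {S T : Set V} {r : V → V → Prop} (h : LinearOn T r) (hST : S ⊆ T) :
    LinearOn S r where
  total hu hv := h.total (hST hu) (hST hv)
  antisymm hu hv := h.antisymm (hST hu) (hST hv)
  eq_of_cycle hu hv hw := h.eq_of_cycle (hST hu) (hST hv) (hST hw)

/-- A relation compatible with a rank function is a linear order as soon as it is one on each fibre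
of the rank. -/
theorem isLinearOrder_of_rank {r : V → V → Prop} (rank : V → ℕ)
    (hmono : ∀ u v, r u v → rank u ≤ rank v) (hlt : ∀ u v, rank u < rank v → r u v)
    (hfibre : ∀ n, LinearOn {v | rank v = n} r) : IsLinearOrder V r where
  refl u := ((hfibre (rank u)).total (u := u) (v := u) rfl rfl).elim id id
  trans u v w huv hvw := by
    rcases ((hmono _ _ huv).trans (hmono _ _ hvw)).lt_or_eq with h | h
    · exact hlt _ _ h
    have hv : rank v = rank w := le_antisymm (hmono _ _ hvw) (h ▸ hmono _ _ huv)
    rcases (hfibre (rank w)).total (u := u) (v := w) h rfl with h' | h'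
    · exact h'
    rcases (hfibre (rank w)).eq_of_cycle h hv rfl huv hvw h' with rfl | rfl | rfl
    exacts [hvw, huv, h']
  antisymm u v huv hvu :=
    (hfibre (rank v)).antisymm (le_antisymm (hmono _ _ huv) (hmono _ _ hvu)) rfl huv hvu
  total u v := by
    rcases lt_trichotomy (rank u) (rank v) with h | h | h
    exacts [.inl (hlt _ _ h), (hfibre (rank v)).total h rfl, .inr (hlt _ _ h)]

/-! ### Square geometric graphs from two orders -/

/-- If the edges of `E` are closed under passing to subintervals, then `E` is a unit interval graph
whose representation is increasing. The points are placed from left to right; the induction keeps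
all distances different from `1`, so that each new point has an open interval to go to. -/
theorem exists_real_abs_sub_le_one_iff [LinearOrder V] [Finite V] (E : V → V → Prop)
    (hE : ∀ u s t v, u ≤ s → s < t → t ≤ v → E u v → E s t) :
    ∃ p : V → ℝ, ∀ s t, s < t → (E s t ↔ |p s - p t| ≤ 1) := by
  classical
  have := Fintype.ofFinite V
  suffices H : ∀ S : Finset V, ∃ p : V → ℝ, ∀ s ∈ S, ∀ t ∈ S, s < t →
      p s < p t ∧ (E s t → p t < p s + 1) ∧ (¬ E s t → p s + 1 < p t) by
    obtain ⟨p, hp⟩ := H Finset.univ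
    refine ⟨p, fun s t hst => ?_⟩
    obtain ⟨h₁, h₂, h₃⟩ := hp s (Finset.mem_univ _) t (Finset.mem_univ _) hst
    rw [abs_of_neg (by linarith)]
    constructor
    · intro h
      linarith [h₂ h]
    · intro h
      by_contra h'
      linarith [h₃ h']
  intro S
  induction S using Finset.induction_on_max with
  | empty => exact ⟨fun _ => 0, by simp⟩
  | insert m S hm ih =>
    obtain ⟨p, hp⟩ := ih
    -- the lower bounds for the position of `m` lie below the upper bounds
    obtain ⟨c, hc₁, hc₂⟩ : ∃ c : ℝ,
        (∀ l ∈ S.image (fun s => if E s m then p s else p s + 1), l < c) ∧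
        ∀ l ∈ (S.filter fun s => E s m).image (fun s => p s + 1), c < l := by
      apply Order.exists_between_finsets
      simp only [Finset.mem_image, Finset.mem_filter]
      rintro _ ⟨s, hs, rfl⟩ _ ⟨t, ⟨ht, htm⟩, rfl⟩
      rcases lt_trichotomy s t with h | rfl | h
      · have := (hp s hs t ht h).1
        split_ifs <;> linarith
      · rw [if_pos htm]
        linarith
      · rw [if_pos (hE t s m m h.le (hm s hs) le_rfl htm)]
        exact (hp t ht s hs h).2.1 (hE t t s m le_rfl h (hm s hs).le htm)
    simp only [Finset.mem_image, Finset.mem_filter, forall_exists_index, and_imp,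
      forall_apply_eq_imp_iff₂] at hc₁ hc₂
    refine ⟨fun v => if v = m then c else p v, fun s hs t ht hst => ?_⟩
    rw [Finset.mem_insert] at hs ht
    rcases hs with rfl | hs
    · rcases ht with rfl | ht
      · exact absurd hst (lt_irrefl _)
      · exact absurd hst (hm t ht).not_gt
    have hsm : s ≠ m := (hm s hs).ne
    rcases ht with rfl | ht
    · simp only [hsm, if_false, if_true]
      have h := hc₁ s hs
      split_ifs at h with h'
      · exact ⟨h, fun _ => hc₂ _ s hs h' rfl, fun h'' => absurd h' h''⟩
      · exact ⟨by linarith, fun h'' => absurd h'' h', fun _ => h⟩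
    · simp only [hsm, (hm t ht).ne, if_false]
      exact hp s hs t ht hst

/-- Joining two vertices when both lie between the ends of some edge of `G` gives a unit interval
graph. -/
theorem exists_real_between_iff [Finite V] {G : SimpleGraph V} {r : V → V → Prop}
    (hr : IsLinearOrder V r) : ∃ p : V → ℝ, ∀ s t, s ≠ t →
      (|p s - p t| ≤ 1 ↔ ∃ u v, r u s ∧ r s v ∧ r u t ∧ r t v ∧ G.Adj u v) := by
  classical
  let _ : LinearOrder V :=
    { le := r
      le_refl := hr.refl
      le_trans := hr.trans
      le_antisymm := hr.antisymm
      le_total := hr.total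
      toDecidableLE := Classical.decRel _ }
  obtain ⟨p, hp⟩ := exists_real_abs_sub_le_one_iff
    (fun s t : V => ∃ u v, u ≤ s ∧ s ≤ v ∧ u ≤ t ∧ t ≤ v ∧ G.Adj u v) (by
      rintro u s t v hus hst htv ⟨u', v', h₁, h₂, h₃, h₄, h₅⟩
      exact ⟨u', v', h₁.trans hus, (hst.le.trans htv).trans h₄, h₁.trans (hus.trans hst.le),
        htv.trans h₄, h₅⟩)
  refine ⟨p, fun s t hst => ?_⟩
  rcases lt_or_gt_of_ne hst with h | h
  · exact (hp s t h).symm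
  · rw [abs_sub_comm, ← hp t s h]
    constructor
    · rintro ⟨u, v, h₁, h₂, h₃, h₄, h₅⟩
      exact ⟨u, v, h₃, h₄, h₁, h₂, h₅⟩
    · rintro ⟨u, v, h₁, h₂, h₃, h₄, h₅⟩
      exact ⟨u, v, h₃, h₄, h₁, h₂, h₅⟩

/-- The two-order condition says that `G` is the intersection of the two unit interval graphs that
its edges span in the two orders; their representations are the coordinates in the plane. -/
theorem TwoOrderCondition.isSquareGeometric [Finite V] {G : SimpleGraph V} {r₁ r₂ : V → V → Prop}
    (h₁ : IsLinearOrder V r₁) (h₂ : IsLinearOrder V r₂) (h : TwoOrderCondition G r₁ r₂) :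
    IsSquareGeometric G := by
  obtain ⟨p, hp⟩ := exists_real_between_iff (G := G) h₁
  obtain ⟨q, hq⟩ := exists_real_between_iff (G := G) h₂
  have hspan : ∀ {r : V → V → Prop}, IsLinearOrder V r → ∀ s t, G.Adj s t →
      ∃ u v, r u s ∧ r s v ∧ r u t ∧ r t v ∧ G.Adj u v := by
    intro r hr s t hst
    rcases hr.total s t with h' | h'
    · exact ⟨s, t, hr.refl s, h', h', hr.refl t, hst⟩
    · exact ⟨t, s, h', hr.refl s, hr.refl t, h', hst.symm⟩
  refine ⟨fun v => (p v, q v), fun s t hst => ?_⟩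
  rw [Prod.dist_eq, max_le_iff, Real.dist_eq, Real.dist_eq, hp s t hst, hq s t hst]
  constructor
  · exact fun hadj => ⟨hspan h₁ s t hadj, hspan h₂ s t hadj⟩
  · rintro ⟨⟨u, v, a₁, a₂, a₃, a₄, a₅⟩, ⟨x, y, b₁, b₂, b₃, b₄, b₅⟩⟩
    exact h u v x y s t hst a₁ a₂ a₃ a₄ a₅ b₁ b₂ b₃ b₄ b₅

/-! ### Completing a partial order -/

/-- `N u ≤ N v`, with ties broken by `tie`. The relations `subX` and `supY` are of this form. -/
def lexTie {α : Type*} [PartialOrder α] (N : V → α) (tie : V → V → Prop) (u v : V) : Prop :=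
  N u < N v ∨ (N u = N v ∧ tie u v)

section LexTie

variable {α : Type*} [PartialOrder α] {N : V → α} {tie : V → V → Prop} {u v w : V}

theorem lexTie.le (h : lexTie N tie u v) : N u ≤ N v := h.elim (fun h => h.le) fun h => h.1.le

theorem lexTie_trans (htie : IsLinearOrder V tie) (h₁ : lexTie N tie u v)
    (h₂ : lexTie N tie v w) : lexTie N tie u w := by
  rcases h₁ with h₁ | ⟨h₁, h₁'⟩
  · exact .inl (h₁.trans_le h₂.le)
  · rcases h₂ with h₂ | ⟨h₂, h₂'⟩
    · exact .inl (h₁ ▸ h₂)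
    · exact .inr ⟨h₁.trans h₂, htie.trans _ _ _ h₁' h₂'⟩

theorem lexTie_antisymm (htie : IsLinearOrder V tie) (h₁ : lexTie N tie u v)
    (h₂ : lexTie N tie v u) : u = v := by
  rcases h₁ with h₁ | ⟨h₁, h₁'⟩
  · exact absurd h₂.le h₁.not_ge
  · rcases h₂ with h₂ | ⟨h₂, h₂'⟩
    · exact absurd h₁ h₂.ne'
    · exact htie.antisymm _ _ h₁' h₂'

theorem lexTie_total (htie : IsLinearOrder V tie) (h : N u ≤ N v ∨ N v ≤ N u) :
    lexTie N tie u v ∨ lexTie N tie v u := by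
  by_cases he : N u = N v
  · exact (htie.total u v).imp (fun ht => .inr ⟨he, ht⟩) fun ht => .inr ⟨he.symm, ht⟩
  · exact h.imp (fun h => .inl (h.lt_of_ne he)) fun h => .inl (h.lt_of_ne (Ne.symm he))

/-- The conditions under which `r`, `p` and the order given by `N` (with ties) together have no
cycles. Both `r` and `p` compare only elements with incomparable values of `N`, apart from the
reflexive pairs of `r`; the last six fields exclude the cycles that involve `p` and are not excluded
by that. Their names list the kinds of the consecutive steps, `s` standing for a step along `N`. -/
structure Completes (N : V → α) (r p : V → V → Prop) : Prop where
  order : IsPartialOrder V r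
  not_le_of_r : ∀ {u v}, u ≠ v → r u v → ¬ N u ≤ N v
  not_ge_of_r : ∀ {u v}, u ≠ v → r u v → ¬ N v ≤ N u
  not_le_of_p : ∀ {u v}, p u v → ¬ N u ≤ N v
  not_ge_of_p : ∀ {u v}, p u v → ¬ N v ≤ N u
  rp : ∀ {u v}, r u v → ¬ p v u
  ppp : ∀ {u v w}, p u v → p v w → ¬ p w u
  spp : ∀ {u v w}, N u ≤ N v → p v w → ¬ p w u
  srp : ∀ {u v w}, N u ≤ N v → v ≠ w → r v w → ¬ p w u
  spr : ∀ {u v w}, N u ≤ N v → p v w → w ≠ u → ¬ r w u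
  rpp : ∀ {u v w}, u ≠ v → r u v → p v w → ¬ p w u

theorem Completes.antisymm {r p : V → V → Prop} (h : Completes N r p) (htie : IsLinearOrder V tie)
    (huv : r u v ∨ lexTie N tie u v ∨ p u v) (hvu : r v u ∨ lexTie N tie v u ∨ p v u) :
    u = v := by
  by_contra hne
  have hne' : v ≠ u := Ne.symm hne
  rcases huv with h₁ | h₁ | h₁ <;> rcases hvu with h₂ | h₂ | h₂
  exacts [hne (h.order.antisymm _ _ h₁ h₂), h.not_ge_of_r hne h₁ h₂.le, h.rp h₁ h₂,
    h.not_ge_of_r hne' h₂ h₁.le, hne (lexTie_antisymm htie h₁ h₂), h.not_ge_of_p h₂ h₁.le,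
    h.rp h₂ h₁, h.not_ge_of_p h₁ h₂.le, h.spp le_rfl h₁ h₂]

theorem Completes.eq_of_cycle {r p : V → V → Prop} (h : Completes N r p)
    (htie : IsLinearOrder V tie) (huv : r u v ∨ lexTie N tie u v ∨ p u v)
    (hvw : r v w ∨ lexTie N tie v w ∨ p v w) (hwu : r w u ∨ lexTie N tie w u ∨ p w u) :
    u = v ∨ v = w ∨ w = u := by
  by_contra! hne
  obtain ⟨h₁, h₂, h₃⟩ := hne
  -- two consecutive steps of kind `r` compose, and so do two of kind `s`
  have rr : ∀ {u v w}, r u v → r v w → w ≠ u → ¬ (r w u ∨ lexTie N tie w u ∨ p w u) := by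
    rintro u v w huv hvw hne (hwu | hwu | hwu)
    · exact hne (h.order.antisymm _ _ hwu (h.order.trans _ _ _ huv hvw))
    · exact h.not_ge_of_r hne.symm (h.order.trans _ _ _ huv hvw) hwu.le
    · exact h.rp (h.order.trans _ _ _ huv hvw) hwu
  have ss : ∀ {u v w}, lexTie N tie u v → lexTie N tie v w → w ≠ u →
      ¬ (r w u ∨ lexTie N tie w u ∨ p w u) := by
    rintro u v w huv hvw hne (hwu | hwu | hwu)
    · exact h.not_ge_of_r hne hwu (huv.le.trans hvw.le)
    · exact hne (lexTie_antisymm htie hwu (lexTie_trans htie huv hvw))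
    · exact h.not_ge_of_p hwu (huv.le.trans hvw.le)
  rcases huv with huv | huv | huv <;> rcases hvw with hvw | hvw | hvw
  · exact rr huv hvw h₃ hwu
  · rcases hwu with hwu | hwu | hwu
    exacts [rr hwu huv h₂ (.inr (.inl hvw)), ss hvw hwu h₁ (.inl huv), h.spr hvw.le hwu h₁ huv]
  · rcases hwu with hwu | hwu | hwu
    exacts [rr hwu huv h₂ (.inr (.inr hvw)), h.srp hwu.le h₁ huv hvw, h.rpp h₁ huv hvw hwu]
  · rcases hwu with hwu | hwu | hwu
    exacts [rr hvw hwu h₁ (.inr (.inl huv)), ss hwu huv h₂ (.inl hvw), h.srp huv.le h₂ hvw hwu]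
  · exact ss huv hvw h₃ hwu
  · rcases hwu with hwu | hwu | hwu
    exacts [h.spr huv.le hvw h₃ hwu, ss hwu huv h₂ (.inr (.inr hvw)), h.spp huv.le hvw hwu]
  · rcases hwu with hwu | hwu | hwu
    exacts [rr hvw hwu h₁ (.inr (.inr huv)), h.spr hwu.le huv h₂ hvw, h.rpp h₂ hvw hwu huv]
  · rcases hwu with hwu | hwu | hwu
    exacts [h.srp hvw.le h₃ hwu huv, ss hvw hwu h₁ (.inr (.inr huv)), h.spp hvw.le hwu huv]
  · rcases hwu with hwu | hwu | hwu
    exacts [h.rpp h₃ hwu huv hvw, h.spp hwu.le huv hvw, h.ppp huv hvw hwu]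

theorem Completes.linearOn {r p R : V → V → Prop} {S : Set V} (h : Completes N r p)
    (htie : IsLinearOrder V tie)
    (hR : ∀ u ∈ S, ∀ v ∈ S, R u v ↔ r u v ∨ lexTie N tie u v ∨ p u v)
    (htotal : ∀ u ∈ S, ∀ v ∈ S, ¬ N u ≤ N v → ¬ N v ≤ N u → R u v ∨ R v u) : LinearOn S R where
  total {u v} hu hv := by
    by_cases hN : N u ≤ N v ∨ N v ≤ N u
    · rw [hR u hu v hv, hR v hv u hu]
      exact (lexTie_total htie hN).imp (fun h => .inr (.inl h)) fun h => .inr (.inl h)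
    · rw [not_or] at hN
      exact htotal u hu v hv hN.1 hN.2
  antisymm hu hv huv hvu := h.antisymm htie ((hR _ hu _ hv).1 huv) ((hR _ hv _ hu).1 hvu)
  eq_of_cycle hu hv hw huv hvw hwu := h.eq_of_cycle htie ((hR _ hu _ hv).1 huv)
    ((hR _ hv _ hw).1 hvw) ((hR _ hw _ hu).1 hwu)

theorem linearOn_lexTie {S : Set V} {R : V → V → Prop} (htie : IsLinearOrder V tie)
    (hR : ∀ u ∈ S, ∀ v ∈ S, R u v ↔ lexTie N tie u v)
    (hN : ∀ u ∈ S, ∀ v ∈ S, N u ≤ N v ∨ N v ≤ N u) : LinearOn S R where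
  total {u v} hu hv := by
    rw [hR u hu v hv, hR v hv u hu]
    exact lexTie_total htie (hN u hu v hv)
  antisymm {u v} hu hv huv hvu :=
    lexTie_antisymm htie ((hR u hu v hv).1 huv) ((hR v hv u hu).1 hvu)
  eq_of_cycle {u v w} hu hv hw huv hvw hwu := .inr (.inr (lexTie_antisymm htie
    ((hR w hw u hu).1 hwu) (lexTie_trans htie ((hR u hu v hv).1 huv) ((hR v hv w hw).1 hvw))))

end LexTie

/-! ### Admissible colourings -/

/-- The relation `<_X` of a colouring, given by the predicate `red` on pairs. In a properly coloured
rigid pair the other chord is blue, so that only one chord has to be inspected. -/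
def precX (G : SimpleGraph V) (X Y : Set V) (red : V → V → Prop) (x x' : V) : Prop :=
  x = x' ∨ ∃ y y', IsRigidPair G X Y x y x' y' ∧ red x y'

/-- The relation `<_Y` of a colouring, in the same encoding as `precX`. -/
def precY (G : SimpleGraph V) (X Y : Set V) (red : V → V → Prop) (y y' : V) : Prop :=
  y = y' ∨ ∃ x x', IsRigidPair G X Y x y x' y' ∧ red x y'

/-- The restriction of `<₁` to `Y`. Its version for the complementary colouring, with `Xa` and `Xb`
exchanged, is the restriction of `<₂` to `Y`. -/
def ordY (G : SimpleGraph V) (X Xa Xb Y : Set V) (red tie : V → V → Prop) (y y' : V) : Prop :=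
  precY G X Y red y y' ∨ supY G X tie y y' ∨ Splits G X (Xa \ Xb) (Xb \ Xa) y y'

/-- The part of the hypotheses on which the argument rests, in a form that is invariant under
exchanging `Xa` with `Xb` and red with blue (`IsAdmissible.compl`). The colouring is given by a
predicate on all pairs of vertices whose values matter only on the chords of rigid pairs. The set
`X` is a parameter, equal to `Xa ∪ Xb`, in order that it stays the same under the exchange. -/
structure IsAdmissible (G : SimpleGraph V) (X Xa Xb Y : Set V) (red : V → V → Prop) : Prop where
  eq_union : X = Xa ∪ Xb
  disjoint : Disjoint X Y
  cover : X ∪ Y = Set.univ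
  clique_Xa : G.IsClique Xa
  clique_Xb : G.IsClique Xb
  clique_Y : G.IsClique Y
  not_adj : ∀ a ∈ Xa \ Xb, ∀ b ∈ Xb \ Xa, ¬ G.Adj a b
  nested_a : NestedNbrs G Y (Xa \ Xb)
  nested_b : NestedNbrs G Y (Xb \ Xa)
  red_iff : ∀ {x y x' y'}, IsRigidPair G X Y x y x' y' → (red x y' ↔ ¬ red x' y)
  red_of_crossing : ∀ {x y x' y'}, IsRigidPair G X Y x y x' y' → x ∈ Xa \ Xb → x' ∉ Xa \ Xb →
    red x y'
  not_red_of_crossing : ∀ {x y x' y'}, IsRigidPair G X Y x y x' y' → x ∈ Xb \ Xa →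
    x' ∉ Xb \ Xa → ¬ red x y'
  precX_order : IsPartialOrder V (precX G X Y red)
  precY_order : IsPartialOrder V (precY G X Y red)

theorem precX_compl {G : SimpleGraph V} {X Y : Set V} {red : V → V → Prop}
    (hred : ∀ {x y x' y'}, IsRigidPair G X Y x y x' y' → (red x y' ↔ ¬ red x' y)) :
    precX G X Y (fun x y => ¬ red x y) = fun x x' => precX G X Y red x' x := by
  ext x x'
  constructor
  · rintro (h | ⟨y, y', h, hr⟩)
    · exact .inl h.symm
    · exact .inr ⟨y', y, h.symm, (hred h.symm).2 hr⟩
  · rintro (h | ⟨y, y', h, hr⟩)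
    · exact .inl h.symm
    · exact .inr ⟨y', y, h.symm, (hred h).1 hr⟩

theorem precY_compl {G : SimpleGraph V} {X Y : Set V} {red : V → V → Prop}
    (hred : ∀ {x y x' y'}, IsRigidPair G X Y x y x' y' → (red x y' ↔ ¬ red x' y)) :
    precY G X Y (fun x y => ¬ red x y) = fun y y' => precY G X Y red y' y := by
  ext y y'
  constructor
  · rintro (h | ⟨x, x', h, hr⟩)
    · exact .inl h.symm
    · exact .inr ⟨x', x, h.symm, (hred h.symm).2 hr⟩
  · rintro (h | ⟨x, x', h, hr⟩)
    · exact .inl h.symm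
    · exact .inr ⟨x', x, h.symm, (hred h).1 hr⟩

theorem isPartialOrder_flip {r : V → V → Prop} (h : IsPartialOrder V r) :
    IsPartialOrder V (fun u v => r v u) where
  refl := h.refl
  trans _ _ _ h₁ h₂ := h.trans _ _ _ h₂ h₁
  antisymm _ _ h₁ h₂ := h.antisymm _ _ h₂ h₁

namespace IsAdmissible

variable {G : SimpleGraph V} {X Xa Xb Y : Set V} {red tie : V → V → Prop}

theorem compl (h : IsAdmissible G X Xa Xb Y red) :
    IsAdmissible G X Xb Xa Y fun x y => ¬ red x y where
  eq_union := h.eq_union.trans (Set.union_comm _ _)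
  disjoint := h.disjoint
  cover := h.cover
  clique_Xa := h.clique_Xb
  clique_Xb := h.clique_Xa
  clique_Y := h.clique_Y
  not_adj a ha b hb hab := h.not_adj b hb a ha hab.symm
  nested_a := h.nested_b
  nested_b := h.nested_a
  red_iff hr := not_congr (h.red_iff hr)
  red_of_crossing := h.not_red_of_crossing
  not_red_of_crossing hr hx hx' := not_not_intro (h.red_of_crossing hr hx hx')
  precX_order := by
    rw [precX_compl h.red_iff]
    exact isPartialOrder_flip h.precX_order
  precY_order := by
    rw [precY_compl h.red_iff]
    exact isPartialOrder_flip h.precY_order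

theorem isRigidPair (h : IsAdmissible G X Xa Xb Y red) {x y x' y' : V}
    (hxx' : (x ∈ Xa ∧ x' ∈ Xa) ∨ (x ∈ Xb ∧ x' ∈ Xb)) (hy : y ∈ Y) (hy' : y' ∈ Y)
    (h₁ : G.Adj x y) (h₂ : G.Adj x' y') (h₃ : ¬ G.Adj x y') (h₄ : ¬ G.Adj x' y) :
    IsRigidPair G X Y x y x' y' := by
  have hne : x ≠ x' := fun e => h₄ (e ▸ h₁)
  have hne' : y ≠ y' := fun e => h₃ (e ▸ h₁)
  have hadj := h.clique_Y hy hy' hne'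
  rcases hxx' with ⟨hx, hx'⟩ | ⟨hx, hx'⟩
  · exact ⟨h.eq_union ▸ .inl hx, h.eq_union ▸ .inl hx', hy, hy', h₁, hadj, h₂,
      h.clique_Xa hx hx' hne, h₃, h₄⟩
  · exact ⟨h.eq_union ▸ .inr hx, h.eq_union ▸ .inr hx', hy, hy', h₁, hadj, h₂,
      h.clique_Xb hx hx' hne, h₃, h₄⟩

/-- By nestedness and non-adjacency, a rigid pair that involves `Xa \ Xb` has its other vertex of
`X` in `Xa ∩ Xb`. Hence every chord at `Xa \ Xb` is a crossing one. -/
theorem mem_inter_of_mem_diff (h : IsAdmissible G X Xa Xb Y red) {x y x' y' : V}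
    (hr : IsRigidPair G X Y x y x' y') (hx : x ∈ Xa \ Xb) : x' ∈ Xa ∩ Xb := by
  have hx' : x' ∈ Xa ∪ Xb := h.eq_union ▸ hr.x₂_mem
  by_cases ha : x' ∈ Xa
  · refine ⟨ha, by_contra fun hb => ?_⟩
    rcases h.nested_a x hx x' ⟨ha, hb⟩ with hn | hn
    · exact hr.chord₂ (hn ⟨hr.y₁_mem, hr.adj₁⟩).2
    · exact hr.chord₁ (hn ⟨hr.y₂_mem, hr.adj₂⟩).2
  · exact absurd hr.adj_x (h.not_adj x hx x' ⟨hx'.resolve_left ha, ha⟩)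

theorem red_of_mem (h : IsAdmissible G X Xa Xb Y red) {x y x' y' : V}
    (hr : IsRigidPair G X Y x y x' y') (hx : x ∈ Xa \ Xb) : red x y' :=
  h.red_of_crossing hr hx fun hx' => hx'.2 (h.mem_inter_of_mem_diff hr hx).2

theorem not_red_of_mem (h : IsAdmissible G X Xa Xb Y red) {x y x' y' : V}
    (hr : IsRigidPair G X Y x y x' y') (hx : x ∈ Xb \ Xa) : ¬ red x y' :=
  h.compl.red_of_mem hr hx

/-- The red chord of a rigid pair starts in `Xa`; by `mem_Xb_of_red` the blue one starts in `Xb`.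
This keeps the vertices of `X` that occur together inside a common clique. -/
theorem mem_Xa_of_red (h : IsAdmissible G X Xa Xb Y red) {x y x' y' : V}
    (hr : IsRigidPair G X Y x y x' y') (hred : red x y') : x ∈ Xa := by
  have hx : x ∈ Xa ∪ Xb := h.eq_union ▸ hr.x₁_mem
  by_contra hxa
  exact h.not_red_of_mem hr ⟨hx.resolve_left hxa, hxa⟩ hred

theorem mem_Xb_of_red (h : IsAdmissible G X Xa Xb Y red) {x y x' y' : V}
    (hr : IsRigidPair G X Y x y x' y') (hred : red x y') : x' ∈ Xb :=
  h.compl.mem_Xa_of_red hr.symm ((h.red_iff hr).1 hred)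

theorem supY_iff {y y' : V} :
    supY G X tie y y' ↔ lexTie (fun y => OrderDual.toDual (nbr G X y)) tie y y' :=
  or_congr Iff.rfl (and_congr_left' eq_comm)

/-! ### The orders on the two sides -/

theorem completesY (h : IsAdmissible G X Xa Xb Y red) :
    Completes (fun y => OrderDual.toDual (nbr G X y)) (precY G X Y red)
      (Splits G X (Xa \ Xb) (Xb \ Xa)) where
  order := h.precY_order
  not_le_of_r hne hr hs := by
    obtain ⟨x, x', hr, -⟩ := hr.resolve_left hne
    exact hr.chord₂ (hs ⟨hr.x₂_mem, hr.adj₂.symm⟩).2.symm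
  not_ge_of_r hne hr hs := by
    obtain ⟨x, x', hr, -⟩ := hr.resolve_left hne
    exact hr.chord₁ (hs ⟨hr.x₁_mem, hr.adj₁.symm⟩).2.symm
  not_le_of_p hp hs := by
    obtain ⟨x, hx⟩ := hp.2.1
    exact hx.2 (hs hx.1)
  not_ge_of_p hp hs := by
    obtain ⟨x, hx⟩ := hp.1
    exact hx.2 (hs hx.1)
  rp := by
    rintro y y' (rfl | ⟨x, x', hr, hred⟩) hp
    · obtain ⟨x, hx⟩ := hp.1
      exact hx.2 hx.1
    · exact h.not_red_of_mem hr (hp.2.2.2 ⟨⟨hr.x₁_mem, hr.adj₁.symm⟩,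
        fun hx => hr.chord₁ hx.2.symm⟩) hred
  ppp := by
    rintro y₁ y₂ y₃ ⟨⟨x, hx⟩, -, h₁, h₁'⟩ ⟨-, -, h₂, h₂'⟩ ⟨-, -, h₃, h₃'⟩
    by_cases hx₃ : x ∈ nbr G X y₃
    · exact (h₁ hx).2 (h₂' ⟨hx₃, hx.2⟩).1
    · exact (h₁ hx).2 (h₃' ⟨hx.1, hx₃⟩).1
  spp := by
    rintro y₁ y₂ y₃ hs ⟨-, -, h₂, h₂'⟩ ⟨⟨x, hx⟩, -, h₃, h₃'⟩
    exact (h₃ hx).2 (h₂' ⟨hx.1, fun hx₂ => hx.2 (hs hx₂)⟩).1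
  srp := by
    rintro y₁ y₂ y₃ hs hne hr ⟨-, -, h₃, h₃'⟩
    obtain ⟨x, x', hr, hred⟩ := hr.resolve_left hne
    exact h.not_red_of_mem hr (h₃' ⟨hs ⟨hr.x₁_mem, hr.adj₁.symm⟩,
      fun hx => hr.chord₁ hx.2.symm⟩) hred
  spr := by
    rintro y₁ y₂ y₃ hs ⟨-, -, h₂, h₂'⟩ hne hr
    obtain ⟨x, x', hr, hred⟩ := hr.resolve_left hne
    exact h.not_red_of_mem hr (h₂' ⟨⟨hr.x₁_mem, hr.adj₁.symm⟩,
      fun hx => hr.chord₁ (hs hx).2.symm⟩) hred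
  rpp := by
    rintro y₁ y₂ y₃ hne hr ⟨-, -, h₂, h₂'⟩ ⟨-, -, h₃, h₃'⟩
    obtain ⟨x, x', hr, hred⟩ := hr.resolve_left hne
    have hx : x ∈ nbr G X y₁ := ⟨hr.x₁_mem, hr.adj₁.symm⟩
    have hx₂ : x ∉ nbr G X y₂ := fun hx => hr.chord₁ hx.2.symm
    by_cases hx₃ : x ∈ nbr G X y₃
    · exact h.not_red_of_mem hr (h₂' ⟨hx₃, hx₂⟩) hred
    · exact h.not_red_of_mem hr (h₃' ⟨hx, hx₃⟩) hred

/-- Two vertices of `Y` with incomparable neighbourhoods form a rigid pair unless all the vertices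
that separate them lie in `Xa \ Xb` on one side and in `Xb \ Xa` on the other. -/
theorem ordY_total (h : IsAdmissible G X Xa Xb Y red) (htie : IsLinearOrder V tie) {y y' : V}
    (hy : y ∈ Y) (hy' : y' ∈ Y) :
    ordY G X Xa Xb Y red tie y y' ∨ ordY G X Xa Xb Y red tie y' y := by
  by_cases hs : nbr G X y' ⊆ nbr G X y ∨ nbr G X y ⊆ nbr G X y'
  · exact (lexTie_total (N := fun y => OrderDual.toDual (nbr G X y)) htie hs).imp
      (fun h => .inr (.inl (supY_iff.2 h))) fun h => .inr (.inl (supY_iff.2 h))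
  by_cases hr : ∃ x x', IsRigidPair G X Y x y x' y'
  · obtain ⟨x, x', hr⟩ := hr
    by_cases hred : red x y'
    · exact .inl (.inl (.inr ⟨x, x', hr, hred⟩))
    · exact .inr (.inl (.inr ⟨x', x, hr.symm, (h.red_iff hr.symm).2 hred⟩))
  push Not at hs hr
  obtain ⟨x', hx', hx'y⟩ := Set.not_subset.1 hs.1
  obtain ⟨x, hx, hxy'⟩ := Set.not_subset.1 hs.2
  -- without a rigid pair, no clique among `Xa` and `Xb` meets both differences
  have key : ∀ z ∈ nbr G X y \ nbr G X y', ∀ z' ∈ nbr G X y' \ nbr G X y,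
      (z ∈ Xa \ Xb ∧ z' ∈ Xb \ Xa) ∨ (z ∈ Xb \ Xa ∧ z' ∈ Xa \ Xb) := by
    rintro z ⟨⟨hz, hzy⟩, hzy'⟩ z' ⟨⟨hz', hz'y'⟩, hz'y⟩
    have hn : ¬ ((z ∈ Xa ∧ z' ∈ Xa) ∨ (z ∈ Xb ∧ z' ∈ Xb)) := fun hc =>
      hr z z' (h.isRigidPair hc hy hy' hzy.symm hz'y'.symm (fun e => hzy' ⟨hz, e.symm⟩)
        fun e => hz'y ⟨hz', e.symm⟩)
    rw [h.eq_union] at hz hz'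
    simp only [Set.mem_union, Set.mem_sdiff] at *
    tauto
  rcases key x ⟨hx, hxy'⟩ x' ⟨hx', hx'y⟩ with ⟨ha, hb⟩ | ⟨hb, ha⟩
  · refine .inl (.inr (.inr ⟨⟨x, hx, hxy'⟩, ⟨x', hx', hx'y⟩, fun z hz => ?_, fun z hz => ?_⟩))
    · exact ((key z hz x' ⟨hx', hx'y⟩).resolve_right fun e => e.2.2 hb.1).1
    · exact ((key x ⟨hx, hxy'⟩ z hz).resolve_right fun e => e.1.2 ha.1).2
  · refine .inr (.inr (.inr ⟨⟨x', hx', hx'y⟩, ⟨x, hx, hxy'⟩, fun z hz => ?_, fun z hz => ?_⟩))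
    · exact ((key x ⟨hx, hxy'⟩ z hz).resolve_left fun e => e.1.2 hb.1).2
    · exact ((key z hz x' ⟨hx', hx'y⟩).resolve_left fun e => e.2.2 ha.1).1

/-- The vertices of `Y` with a neighbour in `Xa \ Xb` form an initial segment. This is what allows
`<₁` to insert `Xb \ Xa` into `Y`. -/
theorem exists_adj_of_ordY (h : IsAdmissible G X Xa Xb Y red) {y y' a : V} (hy' : y' ∈ Y)
    (hyy' : ordY G X Xa Xb Y red tie y y') (ha : a ∈ Xa \ Xb) (hay' : G.Adj a y') :
    ∃ a' ∈ Xa \ Xb, G.Adj a' y := by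
  have haX : a ∈ X := h.eq_union ▸ .inl ha.1
  rcases hyy' with (rfl | ⟨x, x', hr, hred⟩) | hs | hs
  · exact ⟨a, ha, hay'⟩
  · by_contra! hn
    have hx : x ∈ Xa := h.mem_Xa_of_red hr hred
    have hr' := h.isRigidPair (.inl ⟨hx, ha.1⟩) hr.y₁_mem hy' hr.adj₁ hay' hr.chord₁ (hn a ha)
    exact (h.red_iff hr').1 hred (h.red_of_mem hr'.symm ha)
  · exact ⟨a, ha, ((supY_iff.1 hs).le ⟨haX, hay'.symm⟩ : a ∈ nbr G X y).2.symm⟩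
  · obtain ⟨x, hx⟩ := hs.1
    exact ⟨x, hs.2.2.1 hx, hx.1.2.symm⟩

theorem not_subset_of_precX {x x' : V} (hne : x ≠ x') (hx : precX G X Y red x x') :
    ¬ nbr G Y x ⊆ nbr G Y x' := by
  obtain ⟨y, y', hr, -⟩ := hx.resolve_left hne
  exact fun hs => hr.chord₂ (hs ⟨hr.y₁_mem, hr.adj₁⟩).2

theorem not_supset_of_precX {x x' : V} (hne : x ≠ x') (hx : precX G X Y red x x') :
    ¬ nbr G Y x' ⊆ nbr G Y x := by
  obtain ⟨y, y', hr, -⟩ := hx.resolve_left hne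
  exact fun hs => hr.chord₁ (hs ⟨hr.y₂_mem, hr.adj₂⟩).2

theorem completesX₁ (h : IsAdmissible G X Xa Xb Y red) :
    Completes (nbr G Y) (precX G X Y red) (fun _ _ => False) where
  order := h.precX_order
  not_le_of_r := not_subset_of_precX
  not_ge_of_r := not_supset_of_precX
  not_le_of_p := False.elim
  not_ge_of_p := False.elim
  rp _ := id
  ppp h := h.elim
  spp _ h := h.elim
  srp _ _ _ := id
  spr _ h := h.elim
  rpp _ _ h := h.elim

/-- The pairs `b <₂ a` with `a ∈ Xa \ Xb`, `b ∈ Xb \ Xa` whose neighbourhoods are not nested. -/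
def unnested (G : SimpleGraph V) (Xa Xb Y : Set V) (u v : V) : Prop :=
  u ∈ Xb \ Xa ∧ v ∈ Xa \ Xb ∧ ¬ nbr G Y v ⊆ nbr G Y u ∧ ¬ nbr G Y u ⊆ nbr G Y v

theorem completesX₂ (h : IsAdmissible G X Xa Xb Y red) :
    Completes (nbr G Y) (fun x x' => precX G X Y red x' x) (unnested G Xa Xb Y) where
  order := isPartialOrder_flip h.precX_order
  not_le_of_r hne hx := not_supset_of_precX hne.symm hx
  not_ge_of_r hne hx := not_subset_of_precX hne.symm hx
  not_le_of_p hp := hp.2.2.2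
  not_ge_of_p hp := hp.2.2.1
  rp := by
    rintro u v (rfl | ⟨y, y', hr, -⟩) ⟨hb, ha, -, -⟩
    · exact ha.2 hb.1
    · exact h.not_adj _ ha _ hb hr.adj_x.symm
  ppp h₁ h₂ := absurd h₁.2.1.1 h₂.1.2
  spp _ h₂ h₃ := h₂.2.1.2 h₃.1.1
  srp := by
    rintro u v w - hne hr ⟨hb, -⟩
    obtain ⟨y, y', hr, hred⟩ := hr.resolve_left hne.symm
    exact h.not_red_of_mem hr hb hred
  spr := by
    rintro u v w - ⟨-, ha, -⟩ hne hr
    obtain ⟨y, y', hr, hred⟩ := hr.resolve_left hne.symm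
    exact (h.red_iff hr).1 hred (h.red_of_mem hr.symm ha)
  rpp _ _ h₁ h₂ := h₁.2.1.2 h₂.1.1

theorem precX_total (h : IsAdmissible G X Xa Xb Y red) {x x' : V}
    (hxx' : (x ∈ Xa ∧ x' ∈ Xa) ∨ (x ∈ Xb ∧ x' ∈ Xb)) (h₁ : ¬ nbr G Y x ⊆ nbr G Y x')
    (h₂ : ¬ nbr G Y x' ⊆ nbr G Y x) : precX G X Y red x x' ∨ precX G X Y red x' x := by
  obtain ⟨y, hy, hy'⟩ := Set.not_subset.1 h₁
  obtain ⟨z, hz, hz'⟩ := Set.not_subset.1 h₂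
  have hr := h.isRigidPair hxx' hy.1 hz.1 hy.2 hz.2 (fun e => hz' ⟨hz.1, e⟩)
    fun e => hy' ⟨hy.1, e⟩
  by_cases hred : red x z
  · exact .inl (.inr ⟨y, z, hr, hred⟩)
  · exact .inr (.inr ⟨z, y, hr.symm, (h.red_iff hr.symm).2 hred⟩)

/-! ### Non-edges spanned by edges -/

/-- A non-adjacent pair with a vertex in `Xa \ Xb` is never spanned by an edge in the first
order. -/
theorem false_of_mem_diff (h : IsAdmissible G X Xa Xb Y red) {u s t v : V} (hs : s ∈ Xa \ Xb)
    (ht : t ∈ Y) (hv : v ∈ Y) (hus : precX G X Y red u s ∨ nbr G Y u ⊆ nbr G Y s)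
    (htv : ordY G X Xa Xb Y red tie t v) (huv : G.Adj u v) (hst : ¬ G.Adj s t) : False := by
  have hsX : s ∈ X := h.eq_union ▸ .inl hs.1
  have hsub : nbr G Y u ⊆ nbr G Y s := by
    rcases hus with (rfl | ⟨y, y', hr, hred⟩) | hus
    · exact subset_rfl
    · exact absurd (h.red_of_mem hr.symm hs) ((h.red_iff hr).1 hred)
    · exact hus
  have hsv : G.Adj s v := (hsub ⟨hv, huv⟩).2
  rcases htv with (rfl | ⟨x, x', hr, hred⟩) | hsup | hsplit
  · exact hst hsv
  · have hr' := h.isRigidPair (.inl ⟨h.mem_Xa_of_red hr hred, hs.1⟩) ht hv hr.adj₁ hsv hr.chord₁ hst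
    exact (h.red_iff hr').1 hred (h.red_of_mem hr'.symm hs)
  · exact hst ((supY_iff.1 hsup).le ⟨hsX, hsv.symm⟩ : s ∈ nbr G X t).2.symm
  · exact (hsplit.2.2.2 ⟨⟨hsX, hsv.symm⟩, fun e => hst e.2.symm⟩).2 hs.1

/-- If an edge spans the non-edge `st` in the first order, with `s ∈ Xa ∩ Xb`, then `st` is a chord
of a rigid pair and is blue. For the complementary colouring this says that a non-edge spanned in
the second order is a red chord. -/
theorem exists_not_red (h : IsAdmissible G X Xa Xb Y red) {u s t v : V} (hs : s ∈ Xa ∩ Xb)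
    (hu : u ∈ X) (ht : t ∈ Y) (hv : v ∈ Y)
    (hus : precX G X Y red u s ∨ nbr G Y u ⊆ nbr G Y s)
    (htv : ordY G X Xa Xb Y red tie t v) (huv : G.Adj u v) (hst : ¬ G.Adj s t) :
    ∃ w t', IsRigidPair G X Y s t' w t ∧ ¬ red s t := by
  have hsX : s ∈ X := h.eq_union ▸ .inl hs.1
  have hcase : nbr G Y u ⊆ nbr G Y s ∨ ∃ y y', IsRigidPair G X Y u y s y' ∧ red u y' := by
    rcases hus with (rfl | hus) | hsub
    exacts [.inl subset_rfl, .inr hus, .inl hsub]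
  rcases hcase with hsub | ⟨y, y', hr, hred⟩
  · have hsv : G.Adj s v := (hsub ⟨hv, huv⟩).2
    rcases htv with (rfl | ⟨x, x', hr, hred⟩) | hsup | hsplit
    · exact absurd hsv hst
    · have hr' := h.isRigidPair (.inl ⟨h.mem_Xa_of_red hr hred, hs.1⟩) ht hv hr.adj₁ hsv hr.chord₁
        hst
      exact ⟨x, v, hr'.symm, (h.red_iff hr').1 hred⟩
    · exact absurd ((supY_iff.1 hsup).le ⟨hsX, hsv.symm⟩ : s ∈ nbr G X t).2.symm hst
    · exact absurd hs.1 (hsplit.2.2.2 ⟨⟨hsX, hsv.symm⟩, fun e => hst e.2.symm⟩).2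
  · by_cases hut : G.Adj u t
    · -- `u` itself forms the rigid pair with `s`
      have hr' := h.isRigidPair (x' := s) (.inl ⟨h.mem_Xa_of_red hr hred, hs.1⟩) ht hr.y₂_mem hut
        hr.adj₂ hr.chord₁ hst
      exact ⟨u, y', hr'.symm, (h.red_iff hr').1 hred⟩
    rcases htv with (rfl | ⟨p, p', hp, hpred⟩) | hsup | hsplit
    · exact absurd huv hut
    · -- the pair that orders `t` before `v` puts its vertex `p` before `u`, hence before `s`
      have hpu := h.isRigidPair (.inl ⟨h.mem_Xa_of_red hp hpred, h.mem_Xa_of_red hr hred⟩) ht hv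
        hp.adj₁ huv hp.chord₁ hut
      rcases h.precX_order.trans p u s (.inr ⟨t, v, hpu, hpred⟩) (.inr ⟨y, y', hr, hred⟩) with
        rfl | ⟨z, z', hz, hzred⟩
      · exact absurd hp.adj₁ hst
      · have hr' := h.isRigidPair (x' := s) (.inl ⟨h.mem_Xa_of_red hp hpred, hs.1⟩) ht hz.y₂_mem
          hp.adj₁ hz.adj₂ hz.chord₁ hst
        exact ⟨p, z', hr'.symm, (h.red_iff hr').1 hzred⟩
    · exact absurd ((supY_iff.1 hsup).le ⟨hu, huv.symm⟩ : u ∈ nbr G X t).2.symm hut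
    · exact absurd (h.mem_Xa_of_red hr hred)
        (hsplit.2.2.2 ⟨⟨hu, huv.symm⟩, fun e => hut e.2.symm⟩).2

/-- The only use of the rigid-free conditions: a chord `st` with `s ∈ Xa ∩ Xb` is blue when `t` has
a neighbour in `Xa \ Xb`. -/
theorem not_red_of_rigidFree (h : IsAdmissible G (Xa ∪ Xb) Xa Xb Y red)
    (hrf : RigidFreeConditions G Xa Xb Y) {s t t' w a : V} (hs : s ∈ Xa ∩ Xb) (ha : a ∈ Xa \ Xb)
    (hat : G.Adj a t) (hr : IsRigidPair G (Xa ∪ Xb) Y s t' w t) : ¬ red s t := by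
  by_cases hat' : G.Adj a t'
  · by_cases hwa : w ∈ Xa
    · by_cases hwb : w ∈ Xb
      · exact absurd ⟨s, t', w, t, hr, .inl rfl, .inr rfl, ⟨hr.y₁_mem, hat'⟩, ⟨hr.y₂_mem, hat⟩⟩
          ((hrf a ha).1 s hs w ⟨hwa, hwb⟩)
      · exact (h.red_iff hr.symm).1 (h.red_of_mem hr.symm ⟨hwa, hwb⟩)
    · exact absurd ⟨s, t', w, t, hr, .inl rfl, .inr rfl, ⟨hr.y₁_mem, hat'⟩, ⟨hr.y₂_mem, hat⟩⟩
        ((hrf a ha).2 s hs w ⟨hr.x₂_mem.resolve_left hwa, hwa⟩)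
  · have hr' := h.isRigidPair (.inl ⟨ha.1, hs.1⟩) hr.y₂_mem hr.y₁_mem hat hr.adj₁ hat' hr.chord₁
    exact (h.red_iff hr').1 (h.red_of_mem hr' ha)

theorem ordY_compl (h : IsAdmissible G X Xa Xb Y red) {y y' : V} :
    ordY G X Xb Xa Y (fun x y => ¬ red x y) tie y y' ↔ precY G X Y red y' y ∨
      supY G X tie y y' ∨ Splits G X (Xb \ Xa) (Xa \ Xb) y y' := by
  rw [ordY, precY_compl h.red_iff]

/-! ### The orders on all vertices -/

theorem notMem_Y (h : IsAdmissible G (Xa ∪ Xb) Xa Xb Y red) {v : V} (hv : v ∈ Xa ∪ Xb) :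
    v ∉ Y := h.disjoint.notMem_of_mem_left hv

theorem notMem_of_mem_Y (h : IsAdmissible G (Xa ∪ Xb) Xa Xb Y red) {v : V} (hv : v ∈ Y) :
    v ∉ Xa ∧ v ∉ Xb :=
  ⟨fun h' => h.notMem_Y (.inl h') hv, fun h' => h.notMem_Y (.inr h') hv⟩

open Classical in
/-- The position in `<₁` of the block of `v`: `Xa \ Xb`, then `Xa ∩ Xb`, then the vertices of `Y`
with a neighbour in `Xa \ Xb`, then `Xb \ Xa`, then the rest of `Y`. -/
noncomputable def rank₁ (G : SimpleGraph V) (Xa Xb : Set V) (v : V) : ℕ :=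
  if v ∈ Xa then (if v ∈ Xb then 1 else 0) else if v ∈ Xb then 3 else
    if ∃ a ∈ Xa \ Xb, G.Adj a v then 2 else 4

theorem rank₁_diff_a {v : V} (hv : v ∈ Xa \ Xb) : rank₁ G Xa Xb v = 0 := by
  rw [rank₁, if_pos hv.1, if_neg hv.2]

theorem rank₁_inter {v : V} (hv : v ∈ Xa ∩ Xb) : rank₁ G Xa Xb v = 1 := by
  rw [rank₁, if_pos hv.1, if_pos hv.2]

theorem rank₁_diff_b {v : V} (hv : v ∈ Xb \ Xa) : rank₁ G Xa Xb v = 3 := by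
  rw [rank₁, if_neg hv.2, if_pos hv.1]

theorem rank₁_of_exists (h : IsAdmissible G (Xa ∪ Xb) Xa Xb Y red) {v : V} (hv : v ∈ Y)
    (hva : ∃ a ∈ Xa \ Xb, G.Adj a v) : rank₁ G Xa Xb v = 2 := by
  rw [rank₁, if_neg (h.notMem_of_mem_Y hv).1, if_neg (h.notMem_of_mem_Y hv).2, if_pos hva]

theorem rank₁_of_not_exists (h : IsAdmissible G (Xa ∪ Xb) Xa Xb Y red) {v : V} (hv : v ∈ Y)
    (hva : ¬ ∃ a ∈ Xa \ Xb, G.Adj a v) : rank₁ G Xa Xb v = 4 := by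
  rw [rank₁, if_neg (h.notMem_of_mem_Y hv).1, if_neg (h.notMem_of_mem_Y hv).2, if_neg hva]

theorem mem_cases (h : IsAdmissible G (Xa ∪ Xb) Xa Xb Y red) (v : V) :
    (v ∈ Xa \ Xb ∧ rank₁ G Xa Xb v = 0) ∨ (v ∈ Xa ∩ Xb ∧ rank₁ G Xa Xb v = 1) ∨
    (v ∈ Xb \ Xa ∧ rank₁ G Xa Xb v = 3) ∨
    (v ∈ Y ∧ (∃ a ∈ Xa \ Xb, G.Adj a v) ∧ rank₁ G Xa Xb v = 2) ∨
    (v ∈ Y ∧ (¬ ∃ a ∈ Xa \ Xb, G.Adj a v) ∧ rank₁ G Xa Xb v = 4) := by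
  have hv : v ∈ (Xa ∪ Xb) ∪ Y := h.cover ▸ Set.mem_univ v
  by_cases ha : v ∈ Xa
  · by_cases hb : v ∈ Xb
    · exact .inr (.inl ⟨⟨ha, hb⟩, rank₁_inter ⟨ha, hb⟩⟩)
    · exact .inl ⟨⟨ha, hb⟩, rank₁_diff_a ⟨ha, hb⟩⟩
  by_cases hb : v ∈ Xb
  · exact .inr (.inr (.inl ⟨⟨hb, ha⟩, rank₁_diff_b ⟨hb, ha⟩⟩))
  have hY : v ∈ Y := hv.resolve_left fun h' => h'.elim ha hb
  by_cases hva : ∃ a ∈ Xa \ Xb, G.Adj a v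
  · exact .inr (.inr (.inr (.inl ⟨hY, hva, h.rank₁_of_exists hY hva⟩)))
  · exact .inr (.inr (.inr (.inr ⟨hY, hva, h.rank₁_of_not_exists hY hva⟩)))

theorem isLinearOrder_le₁ (h : IsAdmissible G (Xa ∪ Xb) Xa Xb Y red)
    (htie : IsLinearOrder V tie) :
    IsLinearOrder V (le₁ G Xa Xb Y (precX G (Xa ∪ Xb) Y red) (precY G (Xa ∪ Xb) Y red) tie) := by
  refine isLinearOrder_of_rank (rank₁ G Xa Xb) ?_ ?_ ?_
  · rintro u v (⟨hu, hv, -⟩ | ⟨hu, hv, -⟩ | ⟨hu, hv, -⟩ | ⟨hu, hv⟩ | ⟨hu, hv⟩ | ⟨hu, hv⟩ |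
      ⟨hu, hv, huv⟩ | ⟨hu, hv, a, ha, hau⟩ | ⟨hu, hv, hva⟩ | ⟨hu, hv⟩)
    · rw [rank₁_inter hu, rank₁_inter hv]
    · rw [rank₁_diff_a hu, rank₁_diff_a hv]
    · rw [rank₁_diff_b hu, rank₁_diff_b hv]
    · rw [rank₁_diff_a hu]
      exact Nat.zero_le _
    · rw [rank₁_inter hu, rank₁_diff_b hv]
      norm_num
    · rw [rank₁_diff_a hu]
      exact Nat.zero_le _
    · by_cases hva : ∃ a ∈ Xa \ Xb, G.Adj a v
      · obtain ⟨a, ha, hav⟩ := hva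
        rw [h.rank₁_of_exists hv ⟨a, ha, hav⟩,
          h.rank₁_of_exists hu (h.exists_adj_of_ordY hv huv ha hav)]
      · rw [h.rank₁_of_not_exists hv hva]
        by_cases hua : ∃ a ∈ Xa \ Xb, G.Adj a u
        · rw [h.rank₁_of_exists hu hua]
          norm_num
        · rw [h.rank₁_of_not_exists hu hua]
    · rw [h.rank₁_of_exists hu ⟨a, ha, hau.2⟩, rank₁_diff_b hv]
      norm_num
    · rw [rank₁_diff_b hu, h.rank₁_of_not_exists hv fun ⟨a, ha, hav⟩ => hva a ha ⟨hv, hav⟩]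
      norm_num
    · have hv₂ : 2 ≤ rank₁ G Xa Xb v := by
        by_cases hva : ∃ a ∈ Xa \ Xb, G.Adj a v
        · rw [h.rank₁_of_exists hv hva]
        · rw [h.rank₁_of_not_exists hv hva]
          norm_num
      by_cases hub : u ∈ Xb
      · rw [rank₁_inter ⟨hu, hub⟩]
        omega
      · rw [rank₁_diff_a ⟨hu, hub⟩]
        omega
  · intro u v huv
    -- the pairs of blocks whose ranks are not increasing are discarded at once
    rcases h.mem_cases u with ⟨hu, hru⟩ | ⟨hu, hru⟩ | ⟨hu, hru⟩ |
      ⟨hu, hua, hru⟩ | ⟨hu, hua, hru⟩ <;>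
    rcases h.mem_cases v with ⟨hv, hrv⟩ | ⟨hv, hrv⟩ | ⟨hv, hrv⟩ |
      ⟨hv, hva, hrv⟩ | ⟨hv, hva, hrv⟩ <;>
    first
      | (rw [hru, hrv] at huv; norm_num at huv; done)
      | skip
    · exact .inr (.inr (.inr (.inl ⟨hu, hv⟩)))
    · exact .inr (.inr (.inr (.inr (.inr (.inl ⟨hu, hv⟩)))))
    · simp [le₁, hu.1, hv]
    · simp [le₁, hu.1, hv]
    · exact .inr (.inr (.inr (.inr (.inl ⟨hu, hv⟩))))
    · simp [le₁, hu.1, hv]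
    · simp [le₁, hu.1, hv]
    · refine .inr (.inr (.inr (.inr (.inr (.inr (.inr (.inr (.inl ⟨hu, hv, ?_⟩))))))))
      exact fun a ha hav => hva ⟨a, ha, hav.2⟩
    · obtain ⟨a, ha, hau⟩ := hua
      exact .inr (.inr (.inr (.inr (.inr (.inr (.inr (.inl ⟨hu, hv, a, ha, hu, hau⟩)))))))
    · -- `v` before `u` would pass the neighbour of `u` in `Xa \ Xb` on to `v`
      obtain ⟨a, ha, hau⟩ := hua
      have huv' := (h.ordY_total htie hu hv).resolve_right fun hvu =>
        hva (h.exists_adj_of_ordY hu hvu ha hau)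
      exact .inr (.inr (.inr (.inr (.inr (.inr (.inl ⟨hu, hv, huv'⟩))))))
  · have hA : LinearOn (Xa \ Xb) (le₁ G Xa Xb Y (precX G (Xa ∪ Xb) Y red)
        (precY G (Xa ∪ Xb) Y red) tie) := by
      refine linearOn_lexTie htie (fun u hu v hv => ?_) h.nested_a
      simp [le₁, hu.1, hu.2, hv.1, hv.2, h.notMem_Y (.inl hu.1), h.notMem_Y (.inl hv.1), subX,
        lexTie]
    have hB : LinearOn (Xb \ Xa) (le₁ G Xa Xb Y (precX G (Xa ∪ Xb) Y red)
        (precY G (Xa ∪ Xb) Y red) tie) := by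
      refine linearOn_lexTie htie (fun u hu v hv => ?_) h.nested_b
      simp [le₁, hu.1, hu.2, hv.1, hv.2, h.notMem_Y (.inr hu.1), h.notMem_Y (.inr hv.1), subX,
        lexTie]
    have hC : LinearOn (Xa ∩ Xb) (le₁ G Xa Xb Y (precX G (Xa ∪ Xb) Y red)
        (precY G (Xa ∪ Xb) Y red) tie) := by
      refine h.completesX₁.linearOn htie (fun u hu v hv => ?_) fun u hu v hv huv hvu => ?_
      · simp [le₁, hu.1, hu.2, hv.1, hv.2, h.notMem_Y (.inl hu.1), h.notMem_Y (.inl hv.1), subX,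
          lexTie]
      · exact (h.precX_total (.inl ⟨hu.1, hv.1⟩) huv hvu).imp
          (fun h' => .inl ⟨hu, hv, .inl h'⟩) fun h' => .inl ⟨hv, hu, .inl h'⟩
    have hD : LinearOn Y (le₁ G Xa Xb Y (precX G (Xa ∪ Xb) Y red)
        (precY G (Xa ∪ Xb) Y red) tie) := by
      have hord : ∀ u ∈ Y, ∀ v ∈ Y, (le₁ G Xa Xb Y (precX G (Xa ∪ Xb) Y red)
          (precY G (Xa ∪ Xb) Y red) tie u v ↔ ordY G (Xa ∪ Xb) Xa Xb Y red tie u v) := by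
        intro u hu v hv
        obtain ⟨hua, hub⟩ := h.notMem_of_mem_Y hu
        obtain ⟨hva, hvb⟩ := h.notMem_of_mem_Y hv
        simp [le₁, hu, hv, hua, hub, hva, hvb, ordY]
      refine h.completesY.linearOn htie (fun u hu v hv => ?_) fun u hu v hv _ _ => ?_
      · rw [hord u hu v hv, ordY, supY_iff]
      · rw [hord u hu v hv, hord v hv u hu]
        exact h.ordY_total htie hu hv
    intro n
    by_cases hn : n = 0 ∨ n = 1 ∨ n = 3
    · rcases hn with rfl | rfl | rfl
      · refine hA.mono fun v (hv : rank₁ G Xa Xb v = _) => ?_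
        rcases h.mem_cases v with h' | h' | h' | h' | h' <;> first | exact h'.1 | omega
      · refine hC.mono fun v (hv : rank₁ G Xa Xb v = _) => ?_
        rcases h.mem_cases v with h' | h' | h' | h' | h' <;> first | exact h'.1 | omega
      · refine hB.mono fun v (hv : rank₁ G Xa Xb v = _) => ?_
        rcases h.mem_cases v with h' | h' | h' | h' | h' <;> first | exact h'.1 | omega
    · refine hD.mono fun v (hv : rank₁ G Xa Xb v = _) => ?_
      rcases h.mem_cases v with h' | h' | h' | h' | h' <;> first | exact h'.1 | omega

open Classical in
theorem isLinearOrder_le₂ (h : IsAdmissible G (Xa ∪ Xb) Xa Xb Y red)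
    (htie : IsLinearOrder V tie) :
    IsLinearOrder V (le₂ G Xa Xb Y (precX G (Xa ∪ Xb) Y red) (precY G (Xa ∪ Xb) Y red) tie) := by
  have hcover : ∀ v, v ∉ Y → v ∈ Xa ∪ Xb := fun v =>
    ((h.cover ▸ Set.mem_univ v : v ∈ (Xa ∪ Xb) ∪ Y)).resolve_right
  refine isLinearOrder_of_rank (fun v => if v ∈ Y then 1 else 0) ?_ ?_ ?_
  · rintro u v (⟨hu, hv, -⟩ | ⟨hu, hv, -⟩ | ⟨hu, hv, -⟩ | ⟨hu, hv⟩)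
    · simp [h.notMem_Y hu]
    · simp [h.notMem_Y (.inr hu.1)]
    · simp [hu, hv]
    · simp [hv, h.notMem_Y hu]
  · intro u v huv
    have hv : v ∈ Y := by
      by_contra hv
      simp [hv] at huv
    have hu : u ∉ Y := fun hu => by simp [hu, hv] at huv
    exact .inr (.inr (.inr ⟨hcover u hu, hv⟩))
  · have hD : LinearOn Y (le₂ G Xa Xb Y (precX G (Xa ∪ Xb) Y red)
        (precY G (Xa ∪ Xb) Y red) tie) := by
      have hord : ∀ u ∈ Y, ∀ v ∈ Y, (le₂ G Xa Xb Y (precX G (Xa ∪ Xb) Y red)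
          (precY G (Xa ∪ Xb) Y red) tie u v ↔
            ordY G (Xa ∪ Xb) Xb Xa Y (fun x y => ¬ red x y) tie u v) := by
        intro u hu v hv
        obtain ⟨hua, hub⟩ := h.notMem_of_mem_Y hu
        rw [h.ordY_compl]
        simp [le₂, hu, hv, hua, hub]
      refine h.compl.completesY.linearOn htie (fun u hu v hv => ?_) fun u hu v hv _ _ => ?_
      · rw [hord u hu v hv, ordY, supY_iff]
      · rw [hord u hu v hv, hord v hv u hu]
        exact h.compl.ordY_total htie hu hv
    have hX : LinearOn (Xa ∪ Xb) (le₂ G Xa Xb Y (precX G (Xa ∪ Xb) Y red)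
        (precY G (Xa ∪ Xb) Y red) tie) := by
      refine h.completesX₂.linearOn htie (fun u hu v hv => ?_) fun u hu v hv huv hvu => ?_
      · have hu' := h.notMem_Y hu
        have hv' := h.notMem_Y hv
        simp only [le₂, hu, hv, hu', hv', true_and, false_and, and_false, or_false, unnested, subX,
          lexTie, or_assoc]
      · by_cases hxx : (u ∈ Xa ∧ v ∈ Xa) ∨ (u ∈ Xb ∧ v ∈ Xb)
        · exact ((h.precX_total hxx huv hvu).imp (fun h' => .inl ⟨hv, hu, .inl h'⟩)
            fun h' => .inl ⟨hu, hv, .inl h'⟩).symm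
        · by_cases hua : u ∈ Xa
          · have hva : v ∉ Xa := fun hva => hxx (.inl ⟨hua, hva⟩)
            have hvb := hv.resolve_left hva
            exact .inr (.inr (.inl ⟨⟨hvb, hva⟩, ⟨hua, fun hub => hxx (.inr ⟨hub, hvb⟩)⟩, huv, hvu⟩))
          · have hub := hu.resolve_left hua
            have hvb : v ∉ Xb := fun hvb => hxx (.inr ⟨hub, hvb⟩)
            exact .inl (.inr (.inl ⟨⟨hub, hua⟩, ⟨hv.resolve_right hvb, hvb⟩, hvu, huv⟩))
    intro n
    by_cases hn : n = 1
    · refine hD.mono fun v hv => ?_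
      by_contra hvY
      simp [hvY, hn] at hv
    · refine hX.mono fun v hv => hcover v fun hvY => hn ?_
      simpa [hvY] using hv.symm

/-! ### The two-order condition -/

section Between

variable {u s t v x y : V}

/-- What lies below a vertex of `Xa` in the first order. -/
theorem of_le₁_right (h : IsAdmissible G (Xa ∪ Xb) Xa Xb Y red) {ltX ltY : V → V → Prop}
    (hs : s ∈ Xa) (hus : le₁ G Xa Xb Y ltX ltY tie u s) :
    (u ∈ Xa \ Xb ∧ (s ∈ Xb ∨ nbr G Y u ⊆ nbr G Y s)) ∨
      (s ∈ Xb ∧ u ∈ Xa ∩ Xb ∧ (ltX u s ∨ nbr G Y u ⊆ nbr G Y s)) := by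
  have hsY := h.notMem_Y (.inl hs)
  rcases hus with ⟨hu, hs', hus⟩ | ⟨hu, hs', hus⟩ | ⟨hu, hs', hus⟩ | ⟨hu, hs'⟩ | ⟨hu, hs'⟩ |
      ⟨hu, hs'⟩ | ⟨hu, hs', hus⟩ | ⟨hu, hs', -⟩ | ⟨hu, hs', -⟩ | ⟨hu, hs'⟩
  · exact .inr ⟨hs'.2, hu, hus.imp_right lexTie.le⟩
  · exact .inl ⟨hu, .inr (lexTie.le hus)⟩
  · exact absurd hs hs'.2
  · exact .inl ⟨hu, .inl hs'.2⟩
  · exact absurd hs hs'.2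
  · exact absurd hs hs'.2
  · exact absurd hs' hsY
  · exact absurd hs hs'.2
  · exact absurd hs' hsY
  · exact absurd hs' hsY

/-- What lies above a vertex of `Y` in the first order. -/
theorem of_le₁_left_Y (h : IsAdmissible G (Xa ∪ Xb) Xa Xb Y red) (ht : t ∈ Y)
    (htv : le₁ G Xa Xb Y (precX G (Xa ∪ Xb) Y red) (precY G (Xa ∪ Xb) Y red) tie t v) :
    (v ∈ Y ∧ ordY G (Xa ∪ Xb) Xa Xb Y red tie t v) ∨
      (v ∈ Xb \ Xa ∧ ∃ a ∈ Xa \ Xb, G.Adj a t) := by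
  obtain ⟨hta, htb⟩ := h.notMem_of_mem_Y ht
  rcases htv with ⟨ht', -⟩ | ⟨ht', -⟩ | ⟨ht', -⟩ | ⟨ht', -⟩ | ⟨ht', -⟩ | ⟨ht', -⟩ |
      ⟨-, hv, htv⟩ | ⟨-, hv, a, ha, hat⟩ | ⟨ht', -⟩ | ⟨ht', -⟩
  · exact absurd ht'.1 hta
  · exact absurd ht'.1 hta
  · exact absurd ht'.1 htb
  · exact absurd ht'.1 hta
  · exact absurd ht'.1 hta
  · exact absurd ht'.1 hta
  · exact .inl ⟨hv, htv⟩
  · exact .inr ⟨hv, a, ha, hat.2⟩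
  · exact absurd ht'.1 htb
  · exact absurd ht' hta

/-- What lies above a vertex of `Xb \ Xa` in the first order. -/
theorem of_le₁_left_b (h : IsAdmissible G (Xa ∪ Xb) Xa Xb Y red) {ltX ltY : V → V → Prop}
    (ht : t ∈ Xb \ Xa) (htv : le₁ G Xa Xb Y ltX ltY tie t v) :
    v ∈ Xb \ Xa ∨ (v ∈ Y ∧ ∀ a ∈ Xa \ Xb, v ∉ nbr G Y a) := by
  have htY := h.notMem_Y (.inr ht.1)
  rcases htv with ⟨ht', -⟩ | ⟨ht', -⟩ | ⟨-, hv, -⟩ | ⟨ht', -⟩ | ⟨-, hv⟩ | ⟨-, hv⟩ |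
      ⟨ht', -⟩ | ⟨ht', -⟩ | ⟨-, hv, hva⟩ | ⟨ht', -⟩
  · exact absurd ht'.1 ht.2
  · exact absurd ht'.1 ht.2
  · exact .inl hv
  · exact absurd ht'.1 ht.2
  · exact .inl hv
  · exact .inl hv
  · exact absurd ht' htY
  · exact absurd ht' htY
  · exact .inr ⟨hv, hva⟩
  · exact absurd ht' ht.2

/-- What lies below a vertex of `Xa ∪ Xb` in the second order. -/
theorem of_le₂_right (h : IsAdmissible G (Xa ∪ Xb) Xa Xb Y red) {ltX ltY : V → V → Prop}
    (hs : s ∈ Xa ∪ Xb) (hxs : le₂ G Xa Xb Y ltX ltY tie x s) :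
    x ∈ Xa ∪ Xb ∧ (ltX s x ∨ nbr G Y x ⊆ nbr G Y s ∨ s ∈ Xa \ Xb) := by
  rcases hxs with ⟨hx, -, hxs⟩ | ⟨hx, hs', -⟩ | ⟨-, hs', -⟩ | ⟨-, hs'⟩
  · exact ⟨hx, hxs.imp_right fun h' => .inl (lexTie.le h')⟩
  · exact ⟨.inr hx.1, .inr (.inr hs')⟩
  · exact absurd hs' (h.notMem_Y hs)
  · exact absurd hs' (h.notMem_Y hs)

/-- What lies above a vertex of `Y` in the second order. -/
theorem of_le₂_left_Y (h : IsAdmissible G (Xa ∪ Xb) Xa Xb Y red) (ht : t ∈ Y)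
    (hty : le₂ G Xa Xb Y (precX G (Xa ∪ Xb) Y red) (precY G (Xa ∪ Xb) Y red) tie t y) :
    y ∈ Y ∧ ordY G (Xa ∪ Xb) Xb Xa Y (fun x y => ¬ red x y) tie t y := by
  obtain ⟨hta, htb⟩ := h.notMem_of_mem_Y ht
  rcases hty with ⟨ht', -⟩ | ⟨ht', -⟩ | ⟨-, hy, hty⟩ | ⟨ht', -⟩
  · exact absurd ht' (not_or.2 ⟨hta, htb⟩)
  · exact absurd ht'.1 htb
  · exact ⟨hy, h.ordY_compl.2 hty⟩
  · exact absurd ht' (not_or.2 ⟨hta, htb⟩)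

theorem adj_of_between (h : IsAdmissible G (Xa ∪ Xb) Xa Xb Y red)
    (hrf : RigidFreeConditions G Xa Xb Y) (hs : s ∈ Xa ∪ Xb) (ht : t ∈ Y)
    (hus : le₁ G Xa Xb Y (precX G (Xa ∪ Xb) Y red) (precY G (Xa ∪ Xb) Y red) tie u s)
    (htv : le₁ G Xa Xb Y (precX G (Xa ∪ Xb) Y red) (precY G (Xa ∪ Xb) Y red) tie t v)
    (huv : G.Adj u v)
    (hxs : le₂ G Xa Xb Y (precX G (Xa ∪ Xb) Y red) (precY G (Xa ∪ Xb) Y red) tie x s)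
    (hty : le₂ G Xa Xb Y (precX G (Xa ∪ Xb) Y red) (precY G (Xa ∪ Xb) Y red) tie t y)
    (hxy : G.Adj x y) : G.Adj s t := by
  by_contra hst
  obtain ⟨hy, hty⟩ := h.of_le₂_left_Y ht hty
  obtain ⟨hx, hxs⟩ := h.of_le₂_right hs hxs
  have hxs' : s ∈ Xb →
      precX G (Xa ∪ Xb) Y (fun x y => ¬ red x y) x s ∨ nbr G Y x ⊆ nbr G Y s := by
    intro hsb
    rw [precX_compl h.red_iff]
    exact hxs.imp_right fun h' => h'.resolve_right fun hsa => hsa.2 hsb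
  by_cases hsa : s ∈ Xa
  · by_cases hsb : s ∈ Xb
    · -- the second order makes `st` a red chord, the first one forbids that
      obtain ⟨w, t', hr, hred⟩ := h.compl.exists_not_red ⟨hsb, hsa⟩ hx ht hy (hxs' hsb) hty hxy hst
      rcases h.of_le₁_left_Y ht htv with ⟨hv, htv⟩ | ⟨hv, a, ha, hat⟩
      · rcases h.of_le₁_right hsa hus with ⟨hu, -⟩ | ⟨-, hu, hus⟩
        · obtain ⟨a, ha, hat⟩ := h.exists_adj_of_ordY hv htv hu huv
          exact hred (h.not_red_of_rigidFree hrf ⟨hsa, hsb⟩ ha hat hr)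
        · obtain ⟨w, t', -, hred'⟩ := h.exists_not_red ⟨hsa, hsb⟩ (.inl hu.1) ht hv hus htv huv hst
          exact hred hred'
      · exact hred (h.not_red_of_rigidFree hrf ⟨hsa, hsb⟩ ha hat hr)
    · rcases h.of_le₁_right hsa hus with ⟨hu, hus⟩ | ⟨hsb', -⟩
      · rcases h.of_le₁_left_Y ht htv with ⟨hv, htv⟩ | ⟨hv, -⟩
        · exact h.false_of_mem_diff ⟨hsa, hsb⟩ ht hv (.inr (hus.resolve_left hsb)) htv huv hst
        · exact h.not_adj u hu v hv huv
      · exact hsb hsb'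
  · have hsb := hs.resolve_left hsa
    exact h.compl.false_of_mem_diff ⟨hsb, hsa⟩ ht hy (hxs' hsb) hty hxy hst

/-- No edge spans a non-adjacent pair inside `X` in the first order. -/
theorem false_of_between (h : IsAdmissible G (Xa ∪ Xb) Xa Xb Y red) {ltX ltY : V → V → Prop}
    (hs : s ∈ Xa \ Xb) (ht : t ∈ Xb \ Xa) (hus : le₁ G Xa Xb Y ltX ltY tie u s)
    (htv : le₁ G Xa Xb Y ltX ltY tie t v) (huv : G.Adj u v) : False := by
  rcases h.of_le₁_right hs.1 hus with ⟨hu, -⟩ | ⟨hsb, -⟩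
  · rcases h.of_le₁_left_b ht htv with hv | ⟨hv, hva⟩
    · exact h.not_adj u hu v hv huv
    · exact hva u hu ⟨hv, huv⟩
  · exact hs.2 hsb

theorem twoOrderCondition (h : IsAdmissible G (Xa ∪ Xb) Xa Xb Y red)
    (hrf : RigidFreeConditions G Xa Xb Y) :
    TwoOrderCondition G
      (le₁ G Xa Xb Y (precX G (Xa ∪ Xb) Y red) (precY G (Xa ∪ Xb) Y red) tie)
      (le₂ G Xa Xb Y (precX G (Xa ∪ Xb) Y red) (precY G (Xa ∪ Xb) Y red) tie) := by
  intro u v x y s t hst hus hsv hut htv huv hxs hsy hxt hty hxy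
  have hcover : ∀ v, v ∉ Y → v ∈ Xa ∪ Xb := fun v =>
    ((h.cover ▸ Set.mem_univ v : v ∈ (Xa ∪ Xb) ∪ Y)).resolve_right
  by_cases hs : s ∈ Y <;> by_cases ht : t ∈ Y
  · exact h.clique_Y hs ht hst
  · exact (h.adj_of_between hrf (hcover t ht) hs hut hsv huv hxt hsy hxy).symm
  · exact h.adj_of_between hrf (hcover s hs) ht hus htv huv hxs hty hxy
  · by_contra hadj
    have hna : ¬ (s ∈ Xa ∧ t ∈ Xa) := fun h' => hadj (h.clique_Xa h'.1 h'.2 hst)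
    have hnb : ¬ (s ∈ Xb ∧ t ∈ Xb) := fun h' => hadj (h.clique_Xb h'.1 h'.2 hst)
    rcases hcover s hs with hsa | hsb
    · have htb := (hcover t ht).resolve_left fun hta => hna ⟨hsa, hta⟩
      exact h.false_of_between ⟨hsa, fun hsb => hnb ⟨hsb, htb⟩⟩ ⟨htb, fun hta => hna ⟨hsa, hta⟩⟩
        hus htv huv
    · have hta := (hcover t ht).resolve_right fun htb => hnb ⟨hsb, htb⟩
      exact h.false_of_between ⟨hta, fun htb => hnb ⟨hsb, htb⟩⟩ ⟨hsb, fun hsa => hna ⟨hsa, hta⟩⟩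
        hut hsv huv

end Between

theorem ordersWork (h : IsAdmissible G (Xa ∪ Xb) Xa Xb Y red)
    (hrf : RigidFreeConditions G Xa Xb Y) (htie : IsLinearOrder V tie) :
    OrdersWork G Xa Xb Y (precX G (Xa ∪ Xb) Y red) (precY G (Xa ∪ Xb) Y red) tie :=
  ⟨h.isLinearOrder_le₁ htie, h.isLinearOrder_le₂ htie, h.twoOrderCondition hrf⟩

end IsAdmissible

/-! ### From colourings of the chord graph to admissible colourings -/

/-- The pair `xy` is a non-edge coloured red. Pairs that are not vertices of the chord graph count
as not red. -/
def redPair {G : SimpleGraph V} {X Y : Set V} (f : NonEdge G X Y → Colour) (x y : V) : Prop :=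
  ∃ h : x ∈ X ∧ y ∈ Y ∧ ¬ G.Adj x y, f ⟨(x, y), h⟩ = Colour.red

theorem Colour.eq_blue_iff {c : Colour} : c = Colour.blue ↔ c ≠ Colour.red := by
  cases c <;> simp

theorem Colour.swap_eq_red_iff {c : Colour} : c.swap = Colour.red ↔ c = Colour.blue := by
  cases c <;> simp [Colour.swap]

theorem Colour.swap_eq_blue_iff {c : Colour} : c.swap = Colour.blue ↔ c = Colour.red := by
  cases c <;> simp [Colour.swap]

section Colouring

variable {G : SimpleGraph V} {X Y : Set V}

theorem redPair_chord {f : NonEdge G X Y → Colour} {x y x' y' : V}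
    (h : IsRigidPair G X Y x y x' y') : redPair f x y' ↔ f h.chord = Colour.red :=
  ⟨fun ⟨_, hf⟩ => hf, fun hf => ⟨_, hf⟩⟩

theorem redPair_iff_not (f : (chordGraph G X Y).Coloring Colour) {x y x' y' : V}
    (h : IsRigidPair G X Y x y x' y') : redPair f x y' ↔ ¬ redPair f x' y := by
  rw [redPair_chord h, redPair_chord h.symm]
  have hne : f h.chord ≠ f h.symm.chord := f.valid (v := h.chord) (w := h.symm.chord) h
  revert hne
  cases f h.chord <;> cases f h.symm.chord <;> simp

theorem chords_iff (f : (chordGraph G X Y).Coloring Colour) {x y x' y' : V}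
    (h : IsRigidPair G X Y x y x' y') :
    (f h.chord = Colour.red ∧ f h.symm.chord = Colour.blue) ↔ redPair f x y' := by
  rw [Colour.eq_blue_iff, ← redPair_chord h, Ne, ← redPair_chord h.symm]
  exact and_iff_left_of_imp (redPair_iff_not f h).1

theorem relX_eq (f : (chordGraph G X Y).Coloring Colour) :
    relX G X Y f = precX G X Y (redPair f) := by
  ext x x'
  exact or_congr_right (exists₂_congr fun y y' =>
    ⟨fun ⟨h, hf⟩ => ⟨h, (chords_iff f h).1 hf⟩, fun ⟨h, hf⟩ => ⟨h, (chords_iff f h).2 hf⟩⟩)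

theorem relY_eq (f : (chordGraph G X Y).Coloring Colour) :
    relY G X Y f = precY G X Y (redPair f) := by
  ext y y'
  exact or_congr_right (exists₂_congr fun x x' =>
    ⟨fun ⟨h, hf⟩ => ⟨h, (chords_iff f h).1 hf⟩, fun ⟨h, hf⟩ => ⟨h, (chords_iff f h).2 hf⟩⟩)

theorem swap_chords_iff (f : (chordGraph G X Y).Coloring Colour) {x y x' y' : V}
    (h : IsRigidPair G X Y x y x' y') :
    ((f h.chord).swap = Colour.red ∧ (f h.symm.chord).swap = Colour.blue) ↔
      ¬ redPair f x y' := by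
  rw [Colour.swap_eq_red_iff, Colour.swap_eq_blue_iff, and_comm, ← redPair_iff_not f h.symm]
  exact chords_iff f h.symm

theorem relX_swap_eq (f : (chordGraph G X Y).Coloring Colour) :
    (relX G X Y fun u => (f u).swap) = precX G X Y fun x y => ¬ redPair f x y := by
  ext x x'
  exact or_congr_right (exists₂_congr fun y y' =>
    ⟨fun ⟨h, hf⟩ => ⟨h, (swap_chords_iff f h).1 hf⟩,
      fun ⟨h, hf⟩ => ⟨h, (swap_chords_iff f h).2 hf⟩⟩)

theorem relY_swap_eq (f : (chordGraph G X Y).Coloring Colour) :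
    (relY G X Y fun u => (f u).swap) = precY G X Y fun x y => ¬ redPair f x y := by
  ext y y'
  exact or_congr_right (exists₂_congr fun x x' =>
    ⟨fun ⟨h, hf⟩ => ⟨h, (swap_chords_iff f h).1 hf⟩,
      fun ⟨h, hf⟩ => ⟨h, (swap_chords_iff f h).2 hf⟩⟩)

theorem IsBab.isAdmissible {Xa Xb : Set V} (hG : IsBab G Xa Xb Y)
    (f : (chordGraph G (Xa ∪ Xb) Y).Coloring Colour)
    (hA : ∀ u ∈ crossing G (Xa ∪ Xb) Y (Xa \ Xb), f u = Colour.red)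
    (hB : ∀ u ∈ crossing G (Xa ∪ Xb) Y (Xb \ Xa), f u = Colour.blue)
    (hX : IsPartialOrder V (relX G (Xa ∪ Xb) Y f))
    (hY : IsPartialOrder V (relY G (Xa ∪ Xb) Y f))
    (hnA : NestedNbrs G Y (Xa \ Xb)) (hnB : NestedNbrs G Y (Xb \ Xa)) :
    IsAdmissible G (Xa ∪ Xb) Xa Xb Y (redPair f) where
  eq_union := rfl
  disjoint := hG.disjoint
  cover := hG.cover
  clique_Xa := hG.clique_Xa
  clique_Xb := hG.clique_Xb
  clique_Y := hG.clique_Y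
  not_adj := hG.not_adj
  nested_a := hnA
  nested_b := hnB
  red_iff := redPair_iff_not f
  red_of_crossing hr hx hx' := (redPair_chord hr).2 (hA hr.chord ⟨hx, hr.symm.chord, hr, hx'⟩)
  not_red_of_crossing hr hx hx' := fun hred =>
    Colour.eq_blue_iff.1 (hB hr.chord ⟨hx, hr.symm.chord, hr, hx'⟩) ((redPair_chord hr).1 hred)
  precX_order := relX_eq f ▸ hX
  precY_order := relY_eq f ▸ hY

end Colouring

end SquareGeometric

open SquareGeometric in
/-- When the vertices of `Xb \ Xa` satisfy the rigid-free conditions, the orders are those obtained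
by exchanging `Xa` with `Xb` and red with blue. -/
theorem mainTheorem3 {V : Type*} [Finite V] (G : SimpleGraph V) (Xa Xb Y : Set V)
    (hG : StandingAssumption G Xa Xb Y)
    (f : (chordGraph G (Xa ∪ Xb) Y).Coloring Colour)
    (hA : ∀ u ∈ crossing G (Xa ∪ Xb) Y (Xa \ Xb), f u = Colour.red)
    (hB : ∀ u ∈ crossing G (Xa ∪ Xb) Y (Xb \ Xa), f u = Colour.blue)
    (hX : IsPartialOrder V (relX G (Xa ∪ Xb) Y f))
    (hY : IsPartialOrder V (relY G (Xa ∪ Xb) Y f))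
    (hnA : NestedNbrs G Y (Xa \ Xb)) (hnB : NestedNbrs G Y (Xb \ Xa))
    (hrf : RigidFreeConditions G Xa Xb Y ∨ RigidFreeConditions G Xb Xa Y)
    (tie : V → V → Prop) (htie : IsLinearOrder V tie) :
    (RigidFreeConditions G Xa Xb Y →
      OrdersWork G Xa Xb Y (relX G (Xa ∪ Xb) Y f) (relY G (Xa ∪ Xb) Y f) tie) ∧
    (RigidFreeConditions G Xb Xa Y →
      OrdersWork G Xb Xa Y (relX G (Xa ∪ Xb) Y fun u => (f u).swap)
        (relY G (Xa ∪ Xb) Y fun u => (f u).swap) tie) ∧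
    IsSquareGeometric G := by
  have h := hG.bab.isAdmissible f hA hB hX hY hnA hnB
  have h' : IsAdmissible G (Xb ∪ Xa) Xb Xa Y fun x y => ¬ redPair f x y :=
    Set.union_comm Xa Xb ▸ h.compl
  have h₁ : RigidFreeConditions G Xa Xb Y →
      OrdersWork G Xa Xb Y (relX G (Xa ∪ Xb) Y f) (relY G (Xa ∪ Xb) Y f) tie := by
    rw [relX_eq, relY_eq]
    exact fun hrf => h.ordersWork hrf htie
  have h₂ : RigidFreeConditions G Xb Xa Y →
      OrdersWork G Xb Xa Y (relX G (Xa ∪ Xb) Y fun u => (f u).swap)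
        (relY G (Xa ∪ Xb) Y fun u => (f u).swap) tie := by
    rw [relX_swap_eq, relY_swap_eq]
    intro hrf
    have := h'.ordersWork hrf htie
    rwa [Set.union_comm Xb Xa] at this
  refine ⟨h₁, h₂, ?_⟩
  rcases hrf with hrf | hrf
  · exact (h₁ hrf).2.2.isSquareGeometric (h₁ hrf).1 (h₁ hrf).2.1
  · exact (h₂ hrf).2.2.isSquareGeometric (h₂ hrf).1 (h₂ hrf).2.1
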